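/- Setting. A bandit instance with $K\ge 2$ arms is a tuple $\nu=(\nu_1,\dots,\nu_K)$ of reward distributions on $\mathbb R$ with means $\mu_i$; put $\Delta_i=\max_j\mu_j-\mu_i$. The rewards $X^i_s$ ($i\in[K]$, $s\ge1$) are independent with $X^i_s\sim\nu_i$. A bandit algorithm consists, for every $K\ge2$ and every horizon $T$, of decision rules $\pi_t(\cdot\mid A_1,r_1,\dots,A_{t-1},r_{t-1})$, $t\le T$, which are probability distributions on $[K]$ from which $A_t$ is drawn; with $N_{i,t}=\#\{s\le t: A_s=i\}$, the reward collected at time $t$ is $r_t=X^{A_t}_{N_{A_t,t}}$. The random pseudo-regret is $\hat R_T(\nu)=\sum_i\Delta_iN_{i,T}$. Fix $M,\sigma>0$ and an integer $\bar K\ge2$. Let $\mathfrak P_{\mathrm{sg}}$ be the class of all instances with $2\le K\le\bar K$ arms such that every $\nu_i$ has mean $\mu_i\in[-M,M]$ and is $\sigma$-sub-Gaussian, i.e. $\mathbb E_{X\sim\nu_i}[e^{\lambda(X-\mu_i)}]\le e^{\sigma^2\lambda^2/2}$ for all $\lambda\in\mathbb R$, and let $\mathfrak P^2_{\mathrm{sg}}$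 be its subclass of two-armed instances. An algorithm is active-learning if $\frac1T\sup_{\nu\in\mathfrak P_{\mathrm{sg}}}\mathbb E[\hat R_T(\nu)]\to0$ as $T\to\infty$. UCB-f with exploration function $f:\mathbb N\to\mathbb R$ pulls each arm once in the first $K$ rounds, and in each round $t>K$ it pulls an arm that maximizes $\widehat\mu_{i,t-1}+f(t)/\sqrt{N_{i,t-1}}$, where $\widehat\mu_{i,t-1}$ is the average of the rewards collected from arm $i$ before round $t$; the order of the initial pulls and the tie-breaking are arbitrary (possibly randomized). Call $f$ admissible if there is $t_0$ such that, for $t\ge t_0$, $f(t)>0$ and both $f(t)/\log t$ and $\sqrt t/f(t)$ are non-decreasing in $t$. Proposition. (1) There is a constant $c_4>0$, independent of the algorithm, such that every active-learning algorithm satisfies $$\liminf_{T\to\infty}\frac{\log T}{\sqrt T}\,\sup_{\nu\in\mathfrak P_{\mathrm{sg}}}\mathrm{sd}\big(\hat R_T(\nu)\big)>c_4 .$$ (2) There is a constant $c_5>0$ such that, for every admissible $f$, UCB-f satisfies $$\limsup_{T\to\infty}\frac{\sup_{\nu\in\mathfrak P^2_{\mathrm{sg}}}\mathrm{sd}\big(\hat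 R_T(\nu)\big)}{\sqrt T\,\log T}<c_5 .$$ The constants may depend on $M,\sigma,\bar K$ only. -/

import Mathlib

open MeasureTheory ProbabilityTheory Filter Topology
open scoped ENNReal

namespace MAB

noncomputable section

/-! ### Bandit instances -/

/-- A bandit instance with `K` arms: the reward distribution of each arm. -/
abbrev Instance (K : ℕ) : Type := Fin K → ProbabilityMeasure ℝ

/-- Mean reward of arm `i`. -/
def mean {K : ℕ} (ν : Instance K) (i : Fin K) : ℝ := ∫ x, x ∂(ν i : Measure ℝ)

/-- Mean reward gap `Δ_i = max_j μ_j - μ_i`. -/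
def gap {K : ℕ} (ν : Instance K) (i : Fin K) : ℝ := (⨆ j, mean ν j) - mean ν i

/-- Membership in the sub-Gaussian class: every arm has mean in `[-M, M]` and is `σ`-sub-Gaussian,
that is, `E exp (l (X - μ_i)) ≤ exp (σ² l² / 2)` for all real `l`. (The bound on the number of arms
is imposed where suprema over the class are taken.) -/
def IsSubGaussianInstance (M σ : ℝ) {K : ℕ} (ν : Instance K) : Prop :=
  ∀ i, mean ν i ∈ Set.Icc (-M) M ∧
    HasSubgaussianMGF (fun x : ℝ => x - mean ν i) (σ ^ 2).toNNReal (ν i : Measure ℝ)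

/-! ### Policies and the law of a run -/

/-- The history before a round: the (arm, reward) pairs of the first `t` rounds. -/
abbrev History (K t : ℕ) : Type := Fin t → Fin K × ℝ

/-- A (randomized, history dependent) policy for `K` arms and horizon `T`: in the round with
zero-based number `t`, the decision rule is a Markov kernel from histories of length `t` to arms. -/
structure Policy (K T : ℕ) where
  rule : (t : Fin T) → Kernel (History K t) (Fin K)
  isMarkov : ∀ t, IsMarkovKernel (rule t)

/-- A bandit algorithm: a policy for every number `K ≥ 2` of arms and every horizon. -/
abbrev Algorithm : Type := (K : ℕ) → 2 ≤ K → (T : ℕ) → Policy K T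

/-- Number of pulls of arm `i` among the first `t` rounds of the action sequence `a`. -/
def pulls {K n : ℕ} (a : Fin n → Fin K) (i : Fin K) (t : ℕ) : ℕ :=
  (Finset.univ.filter (fun s : Fin n => (s : ℕ) < t ∧ a s = i)).card

/-- The reward table: `x (i, s)` is the reward of the pull number `s + 1` of arm `i`. -/
abbrev Table (K : ℕ) : Type := Fin K × ℕ → ℝ

/-- The reward collected in round `t`: the first entry of the row of the pulled arm that has not
been used in the earlier rounds. -/
def reward {K T : ℕ} (x : Table K) (a : Fin T → Fin K) (t : Fin T) : ℝ :=
  x (a t, pulls a (a t) t)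

/-- The history of the first `t` rounds, from the reward table and the action sequence. -/
def history {K T : ℕ} (x : Table K) (a : Fin T → Fin K) (t : Fin T) : History K t :=
  fun s => (a (s.castLE t.isLt.le), reward x a (s.castLE t.isLt.le))

/-- Conditional probability, given the reward table, that the policy plays the action sequence `a`:
the product of the probabilities of the successive actions given the histories. -/
def playProb {K T : ℕ} (π : Policy K T) (x : Table K) (a : Fin T → Fin K) : ℝ≥0∞ :=
  ∏ t : Fin T, π.rule t (history x a t) {a t}

/-- All entries of the reward table are independent, and row `i` has law `ν i`. -/
def tableLaw {K : ℕ} (ν : Instance K) : Measure (Table K) :=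
  Measure.infinitePi (fun p : Fin K × ℕ => (ν p.1 : Measure ℝ))

/-- Joint law of the reward table and of the action sequence `A_1, …, A_T` when `π` is run
on `ν`. -/
def runLaw {K T : ℕ} (π : Policy K T) (ν : Instance K) : Measure (Table K × (Fin T → Fin K)) :=
  ∑ a : Fin T → Fin K,
    ((tableLaw ν).withDensity (fun x => playProb π x a)).map (fun x => (x, a))

/-- The random pull count `N_{i,T}`. -/
def pullCount {K T : ℕ} (i : Fin K) (ω : Table K × (Fin T → Fin K)) : ℝ :=
  (pulls ω.2 i T : ℝ)

/-- The random pseudo-regret `∑ i, Δ_i N_{i,T}`. -/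
def pseudoRegret {K T : ℕ} (ν : Instance K) (ω : Table K × (Fin T → Fin K)) : ℝ :=
  ∑ i, gap ν i * pullCount i ω

/-- The expected pseudo-regret `∑ i, Δ_i E[N_{i,T}]`. -/
def expectedRegret {K T : ℕ} (π : Policy K T) (ν : Instance K) : ℝ :=
  ∑ i, gap ν i * ∫ ω, pullCount i ω ∂(runLaw π ν)

/-- The regret variability: standard deviation of the random pseudo-regret. -/
def regretSD {K T : ℕ} (π : Policy K T) (ν : Instance K) : ℝ :=
  √(variance (pseudoRegret ν) (runLaw π ν))

/-! ### Worst cases over the instance class -/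

/-- Worst-case expected regret at horizon `T` over the sub-Gaussian class. -/
def worstRegret (M σ : ℝ) (Kbar : ℕ) (alg : Algorithm) (T : ℕ) : ℝ≥0∞ :=
  ⨆ (K : ℕ) (hK : 2 ≤ K) (_ : K ≤ Kbar) (ν : Instance K) (_ : IsSubGaussianInstance M σ ν),
    ENNReal.ofReal (expectedRegret (alg K hK T) ν)

/-- Worst-case regret variability at horizon `T` over the sub-Gaussian class. -/
def worstRegretSD (M σ : ℝ) (Kbar : ℕ) (alg : Algorithm) (T : ℕ) : ℝ≥0∞ :=
  ⨆ (K : ℕ) (hK : 2 ≤ K) (_ : K ≤ Kbar) (ν : Instance K) (_ : IsSubGaussianInstance M σ ν),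
    ENNReal.ofReal (regretSD (alg K hK T) ν)

/-- Worst-case regret variability at horizon `T` over the two-armed instances of the class. -/
def worstRegretSDTwo (M σ : ℝ) (alg : Algorithm) (T : ℕ) : ℝ≥0∞ :=
  ⨆ (ν : Instance 2) (_ : IsSubGaussianInstance M σ ν),
    ENNReal.ofReal (regretSD (alg 2 le_rfl T) ν)

/-- Active learning: the worst-case expected regret is sublinear. -/
def IsActiveLearning (M σ : ℝ) (Kbar : ℕ) (alg : Algorithm) : Prop :=
  Tendsto (fun T : ℕ => worstRegret M σ Kbar alg T / (T : ℝ≥0∞)) atTop (𝓝 0)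

/-! ### UCB-f -/

/-- Number of pulls of arm `i` in a history. -/
def histPulls {K t : ℕ} (h : History K t) (i : Fin K) : ℕ :=
  pulls (fun s => (h s).1) i t

/-- Empirical mean reward of arm `i` in a history. -/
def empMean {K t : ℕ} (h : History K t) (i : Fin K) : ℝ :=
  (∑ s, if (h s).1 = i then (h s).2 else 0) / (histPulls h i : ℝ)

/-- The index of arm `i` in the round that follows a history of length `t`, which is the round
number `t + 1`. -/
def ucbIndex (f : ℕ → ℝ) {K t : ℕ} (h : History K t) (i : Fin K) : ℝ :=
  empMean h i + f (t + 1) / √(histPulls h i : ℝ)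

/-- The arms that UCB-f may play after the history `h`: in the first `K` rounds the arms not yet
pulled, and later the maximizers of the index. -/
def ucbChoices (f : ℕ → ℝ) {K t : ℕ} (h : History K t) : Set (Fin K) :=
  {i | (t < K → histPulls h i = 0) ∧ (K ≤ t → ∀ j, ucbIndex f h j ≤ ucbIndex f h i)}

/-- The algorithm is UCB-f, with any (possibly randomized, history dependent) order of the initial
pulls and any such way to break ties. -/
def IsUCB (f : ℕ → ℝ) (alg : Algorithm) : Prop :=
  ∀ (K : ℕ) (hK : 2 ≤ K) (T : ℕ) (t : Fin T) (h : History K t),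
    (alg K hK T).rule t h (ucbChoices f h)ᶜ = 0

/-- Admissible exploration functions: eventually positive, with `f t / log t` and `√t / f t`
eventually non-decreasing. (The two ratios cannot both be non-decreasing from `t = 2` on, as their
product `√t / log t` decreases for `2 ≤ t ≤ 7`.) -/
def IsAdmissible (f : ℕ → ℝ) : Prop :=
  ∃ t₀ : ℕ, 2 ≤ t₀ ∧ (∀ t, t₀ ≤ t → 0 < f t) ∧
    MonotoneOn (fun t : ℕ => f t / Real.log t) (Set.Ici t₀) ∧
    MonotoneOn (fun t : ℕ => √(t : ℝ) / f t) (Set.Ici t₀)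

end

end MAB

/-! ### Change of measure for product measures -/

/-! Lower bound. Take two arms on `{σ, -σ}`, of means `0` and `σ z` with `|z| ≤ δ`, and let `u z` be
the expected number of pulls of the second arm. Sublinear regret forces `u δ - u (-δ) ≥ T / 2` for
large `T`. Moving `z` by at most `1 / (2√T)` changes the law of the reward table by a bounded χ²
divergence, so by Chapman–Robbins (`sq_integral_sub_integral_le`) `u` moves by at most the standard
deviation of the pull count at one endpoint. The regret deviation at `z` is `σ |z|` times that
standard deviation; if it is at most `S`, a step charged to `z` moves `u` by at most `S / (σ |z|)`.
A grid with about `√T` steps on each side of `0`, each step charged to its endpoint farther from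
`0`, gives a harmonic sum. Hence `T / 2` is at most a multiple of `S √T log T`, and `S` is at least
of order `√T / log T`.

Upper bound. On an event where every partial sum of the table is within `b √n` of its mean, with `b`
of order `√(log T)`, UCB-f is nearly deterministic. The count of the worse arm stays close to the
solution `n` of `n + m = T`, `1/√n - 1/√m = Δ / f T`, at which the two noiseless indices agree.
Whichever arm exceeds its share, its last pull won an index comparison; this bounds the excess, and
after multiplication by `Δ` the bound does not involve `f` (`gap_mul_sub_le_of_suboptimal_pull`,
`gap_mul_sub_le_of_optimal_pull`). The regret thus lies within `O(√(T log T))` of the constant `Δ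
n`, and the exceptional event is too rare to matter. This order is smaller than `√T log T`, so `c₅ =
1` suffices. -/

theorem MeasureTheory.Measure.pi_eq_withDensity {ι X : Type*} [Fintype ι] [MeasurableSpace X]
    {μ μ' : ι → Measure X} [∀ i, IsProbabilityMeasure (μ i)] [∀ i, IsProbabilityMeasure (μ' i)]
    {l : ι → X → ℝ≥0∞} (hl : ∀ i, Measurable (l i)) (h : ∀ i, μ' i = (μ i).withDensity (l i)) :
    Measure.pi μ' = (Measure.pi μ).withDensity (fun x => ∏ i, l i (x i)) := by
  refine Measure.pi_eq fun s hs => ?_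
  have hind : ∀ x : ι → X, (Set.univ.pi s).indicator (fun x => ∏ i, l i (x i)) x
      = ∏ i, (s i).indicator (l i) (x i) := by
    intro x
    by_cases hx : x ∈ Set.univ.pi s
    · rw [Set.indicator_of_mem hx]
      exact Finset.prod_congr rfl fun i _ => (Set.indicator_of_mem (hx i trivial) _).symm
    · rw [Set.indicator_of_notMem hx]
      simp only [Set.mem_pi, Set.mem_univ, true_implies, not_forall] at hx
      obtain ⟨i, hi⟩ := hx
      exact (Finset.prod_eq_zero (Finset.mem_univ i) (Set.indicator_of_notMem hi _)).symm
  have hm : ∀ i, Measurable ((s i).indicator (l i)) := fun i => (hl i).indicator (hs i)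
  rw [withDensity_apply _ (MeasurableSet.univ_pi hs),
    ← lintegral_indicator (MeasurableSet.univ_pi hs)]
  simp_rw [hind]
  have hi : iIndepFun (fun i (x : ι → X) => (s i).indicator (l i) (x i)) (Measure.pi μ) :=
    iIndepFun_pi (fun i => (hm i).aemeasurable)
  rw [lintegral_prod_eq_prod_lintegral_of_indepFun Finset.univ _ hi
    (fun i => (hm i).comp (measurable_pi_apply i))]
  refine Finset.prod_congr rfl fun i _ => ?_
  rw [h i, withDensity_apply _ (hs i), ← lintegral_indicator (hs i)]
  exact (measurePreserving_eval μ i).lintegral_comp (hm i)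

/-- The two infinite products may be mutually singular, so densities are available only for
functionals of finitely many coordinates; for these both sides reduce to a finite product. -/
theorem MeasureTheory.Measure.lintegral_infinitePi_withDensity {ι X : Type*} [MeasurableSpace X]
    {μ μ' : ι → Measure X} [∀ i, IsProbabilityMeasure (μ i)] [∀ i, IsProbabilityMeasure (μ' i)]
    {l : ι → X → ℝ≥0∞} (hl : ∀ i, Measurable (l i)) (h : ∀ i, μ' i = (μ i).withDensity (l i))
    (S : Finset ι) {g : (ι → X) → ℝ≥0∞} (hg : Measurable g)
    (hS : ∀ x y, (∀ i ∈ S, x i = y i) → g x = g y) :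
    ∫⁻ x, g x ∂(Measure.infinitePi μ')
      = ∫⁻ x, (∏ i ∈ S, l i (x i)) * g x ∂(Measure.infinitePi μ) := by
  classical
  rcases isEmpty_or_nonempty (ι → X) with he | ⟨⟨x₀⟩⟩
  · simp [lintegral_of_isEmpty]
  set G : (S → X) → ℝ≥0∞ := fun y => g (Function.updateFinset x₀ S y) with hG
  have hGm : Measurable G := hg.comp measurable_updateFinset
  have hgG : ∀ x, g x = G (S.restrict x) := fun x => hS _ _ fun i hi => by
    simp [Function.updateFinset, hi]
  have hprod : ∀ x : ι → X, ∏ i ∈ S, l i (x i) = ∏ i : S, l i (S.restrict x i) := fun x => by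
    rw [← Finset.prod_coe_sort]; rfl
  simp_rw [hprod, hgG]
  have hLm : Measurable fun y : S → X => ∏ i : S, l i (y i) :=
    Finset.measurable_prod _ fun i _ => (hl i).comp (measurable_pi_apply i)
  have h1 := lintegral_restrict_infinitePi (X := fun _ : ι => X) (μ := μ') (s := S) hGm
  have h2 := lintegral_restrict_infinitePi (X := fun _ : ι => X) (μ := μ) (s := S)
    (hLm.mul hGm)
  rw [h1, Measure.pi_eq_withDensity (fun i : S => hl i) (fun i => h i),
    lintegral_withDensity_eq_lintegral_mul _ hLm hGm]
  exact h2.symm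

/-! ### The law of a run -/

namespace MAB

/-- The last factor is the only one that sees the last action, so that action sums out to `1` and
the horizon drops by one. -/
theorem sum_prod_prefix_eq_one {A : Type*} [Fintype A] (q : (t : ℕ) → (Fin t → A) → A → ℝ≥0∞)
    (n : ℕ) (hq : ∀ t < n, ∀ h, ∑ i, q t h i = 1) :
    ∑ a : Fin n → A, ∏ t : Fin n, q t (fun s : Fin t => a (s.castLE t.isLt.le)) (a t) = 1 := by
  induction n with
  | zero => simp
  | succ n ih =>
    rw [← (Fin.snocEquiv (fun _ : Fin (n + 1) => A)).sum_comp, Fintype.sum_prod_type_right]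
    rw [← ih fun t ht => hq t (by omega)]
    refine Finset.sum_congr rfl fun b _ => ?_
    have key : ∀ i : A, ∏ t : Fin (n + 1), q t
        (fun s : Fin t => (Fin.snocEquiv (fun _ : Fin (n + 1) => A)) (i, b) (s.castLE t.isLt.le))
        ((Fin.snocEquiv (fun _ : Fin (n + 1) => A)) (i, b) t)
        = (∏ t : Fin n, q t (fun s : Fin t => b (s.castLE t.isLt.le)) (b t)) * q n b i := by
      intro i
      rw [Fin.prod_univ_castSucc]
      congr 1
      · refine Finset.prod_congr rfl fun t _ => ?_
        congr 1
        · funext s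
          exact Fin.snoc_castSucc (α := fun _ : Fin (n + 1) => A) i b (s.castLE t.isLt.le)
        · exact Fin.snoc_castSucc (α := fun _ : Fin (n + 1) => A) i b t
      · congr 1
        · funext s
          exact Fin.snoc_castSucc (α := fun _ : Fin (n + 1) => A) i b s
        · exact Fin.snoc_last (α := fun _ : Fin (n + 1) => A) i b
    simp_rw [key]
    rw [← Finset.mul_sum, hq n (by omega), mul_one]

theorem pulls_zero {K n : ℕ} (a : Fin n → Fin K) (i : Fin K) : pulls a i 0 = 0 := by
  simp [pulls]

theorem pulls_succ {K n : ℕ} (a : Fin n → Fin K) (i : Fin K) (t : Fin n) :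
    pulls a i (t + 1) = pulls a i t + if a t = i then 1 else 0 := by
  unfold pulls
  split_ifs with h
  · rw [← Finset.card_insert_of_notMem (a := t) (by simp)]
    congr 1
    ext s
    simp only [Finset.mem_filter, Finset.mem_univ, true_and, Finset.mem_insert]
    constructor
    · rintro ⟨h1, h2⟩
      by_cases hs : s = t
      · exact Or.inl hs
      · exact Or.inr ⟨by have := Fin.val_ne_of_ne hs; omega, h2⟩
    · rintro (rfl | ⟨h1, h2⟩)
      · exact ⟨by omega, h⟩
      · exact ⟨by omega, h2⟩
  · rw [add_zero]
    congr 1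
    ext s
    simp only [Finset.mem_filter, Finset.mem_univ, true_and]
    constructor
    · rintro ⟨h1, h2⟩
      by_cases hs : s = t
      · exact absurd (hs ▸ h2) h
      · exact ⟨by have := Fin.val_ne_of_ne hs; omega, h2⟩
    · rintro ⟨h1, h2⟩
      exact ⟨by omega, h2⟩

theorem sum_pulls {K n : ℕ} (a : Fin n → Fin K) {t : ℕ} (ht : t ≤ n) :
    ∑ i, pulls a i t = t := by
  induction t with
  | zero => simp [pulls_zero]
  | succ t ih =>
    have := fun i => pulls_succ a i ⟨t, ht⟩
    simp only at this
    simp_rw [this, Finset.sum_add_distrib, ih (by omega)]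
    simp

theorem pulls_le {K n : ℕ} (a : Fin n → Fin K) (i : Fin K) {t : ℕ} (ht : t ≤ n) :
    pulls a i t ≤ t := by
  conv_rhs => rw [← sum_pulls a ht]
  exact Finset.single_le_sum (f := fun i => pulls a i t) (fun _ _ => Nat.zero_le _)
    (Finset.mem_univ i)

theorem pulls_prefix {K n m : ℕ} (a : Fin n → Fin K) (hm : m ≤ n) (i : Fin K) {t : ℕ}
    (ht : t ≤ m) : pulls (fun s : Fin m => a (s.castLE hm)) i t = pulls a i t := by
  induction t with
  | zero => simp [pulls_zero]
  | succ t ih =>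
    have h1 := pulls_succ (fun s : Fin m => a (s.castLE hm)) i ⟨t, ht⟩
    have h2 := pulls_succ a i ⟨t, by omega⟩
    simp only [Fin.castLE_mk] at h1 h2
    rw [h1, h2, ih (by omega)]

theorem pulls_fin_two {n : ℕ} (a : Fin n → Fin 2) {t : ℕ} (ht : t ≤ n) {i j : Fin 2}
    (hij : i ≠ j) : pulls a i t + pulls a j t = t := by
  have := sum_pulls a ht
  rw [Fin.sum_univ_two] at this
  fin_cases i <;> fin_cases j <;> simp at hij ⊢ <;> omega

theorem history_congr {K T : ℕ} {x y : Table K} (a : Fin T → Fin K) (t : Fin T)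
    (h : ∀ p ∈ (Finset.univ : Finset (Fin K)) ×ˢ Finset.range T, x p = y p) :
    history x a t = history y a t := by
  funext s
  refine Prod.ext rfl (h _ ?_)
  simp only [Finset.mem_product, Finset.mem_univ, true_and, Finset.mem_range]
  have h1 := pulls_le a (a (s.castLE t.isLt.le)) (t := s) (by omega)
  have h2 := s.isLt
  have h3 := t.isLt
  exact lt_of_le_of_lt h1 (by omega)

theorem playProb_congr {K T : ℕ} (π : Policy K T) {x y : Table K} (a : Fin T → Fin K)
    (h : ∀ p ∈ (Finset.univ : Finset (Fin K)) ×ˢ Finset.range T, x p = y p) :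
    playProb π x a = playProb π y a := by
  unfold playProb
  exact Finset.prod_congr rfl fun t _ => by rw [history_congr a t h]

theorem measurable_history {K T : ℕ} (a : Fin T → Fin K) (t : Fin T) :
    Measurable fun x : Table K => history x a t :=
  measurable_pi_iff.2 fun _ => measurable_const.prodMk (measurable_pi_apply _)

theorem measurable_playProb {K T : ℕ} (π : Policy K T) (a : Fin T → Fin K) :
    Measurable fun x : Table K => playProb π x a :=
  Finset.measurable_prod _ fun t _ =>
    (Kernel.measurable_coe (π.rule t) (MeasurableSet.singleton _)).comp (measurable_history a t)

theorem sum_playProb {K T : ℕ} (π : Policy K T) (x : Table K) :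
    ∑ a, playProb π x a = 1 := by
  -- The rules are rewritten as functions of the action prefix alone, with the table fixed; the
  -- value `0` past the horizon is never read.
  set q : (t : ℕ) → (Fin t → Fin K) → Fin K → ℝ≥0∞ := fun t b i =>
    if h : t < T then π.rule ⟨t, h⟩ (fun s => (b s, x (b s, pulls b (b s) s))) {i} else 0 with hq
  rw [← sum_prod_prefix_eq_one q T]
  · refine Finset.sum_congr rfl fun a _ => Finset.prod_congr rfl fun t _ => ?_
    simp only [hq, t.isLt, dite_true]
    congr 2
    funext s
    refine Prod.ext rfl ?_
    simp only [history, reward]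
    rw [pulls_prefix a t.isLt.le _ s.isLt.le]
    rfl
  · intro t ht b
    have := π.isMarkov ⟨t, ht⟩
    simp only [hq, ht, dite_true]
    rw [sum_measure_singleton, Finset.coe_univ, measure_univ]

instance isProbabilityMeasure_tableLaw {K : ℕ} (ν : Instance K) :
    IsProbabilityMeasure (tableLaw ν) := by
  unfold tableLaw; infer_instance

theorem measurable_mk_run {K T : ℕ} (a : Fin T → Fin K) :
    Measurable fun x : Table K => (x, a) := measurable_id.prodMk measurable_const

theorem lintegral_runLaw {K T : ℕ} (π : Policy K T) (ν : Instance K)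
    {g : Table K × (Fin T → Fin K) → ℝ≥0∞} (hg : Measurable g) :
    ∫⁻ ω, g ω ∂(runLaw π ν) = ∑ a, ∫⁻ x, playProb π x a * g (x, a) ∂(tableLaw ν) := by
  unfold runLaw
  rw [lintegral_finsetSum_measure]
  refine Finset.sum_congr rfl fun a _ => ?_
  rw [lintegral_map hg (measurable_mk_run a)]
  exact lintegral_withDensity_eq_lintegral_mul _
    (measurable_playProb π a) (hg.comp (measurable_mk_run a))

theorem lintegral_runLaw_fst {K T : ℕ} (π : Policy K T) (ν : Instance K)
    {g : Table K → ℝ≥0∞} (hg : Measurable g) :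
    ∫⁻ ω, g ω.1 ∂(runLaw π ν) = ∫⁻ x, g x ∂(tableLaw ν) := by
  rw [lintegral_runLaw π ν (g := fun ω => g ω.1) (hg.comp measurable_fst),
    ← lintegral_finsetSum (f := fun a x => playProb π x a * g x) _
      fun a _ => (measurable_playProb π a).mul hg]
  simp_rw [← Finset.sum_mul, sum_playProb, one_mul]

instance isProbabilityMeasure_runLaw {K T : ℕ} (π : Policy K T) (ν : Instance K) :
    IsProbabilityMeasure (runLaw π ν) :=
  ⟨by simpa using lintegral_runLaw_fst π ν (g := fun _ => 1) measurable_const⟩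

theorem map_fst_runLaw {K T : ℕ} (π : Policy K T) (ν : Instance K) :
    (runLaw π ν).map Prod.fst = tableLaw ν := by
  ext s hs
  rw [← lintegral_indicator_one hs, ← lintegral_indicator_one hs,
    lintegral_map (measurable_one.indicator hs) measurable_fst]
  exact lintegral_runLaw_fst π ν (measurable_one.indicator hs)

/-- Turns a constraint on the decision rules into an almost sure property of the realized actions.
-/
theorem ae_runLaw_playProb_ne_zero {K T : ℕ} (π : Policy K T) (ν : Instance K) :
    ∀ᵐ ω ∂(runLaw π ν), playProb π ω.1 ω.2 ≠ 0 := by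
  have hm : MeasurableSet {ω : Table K × (Fin T → Fin K) | playProb π ω.1 ω.2 = 0} := by
    refine measurableSet_eq_fun ?_ measurable_const
    exact measurable_from_prod_countable_left fun a => measurable_playProb π a
  have h := lintegral_runLaw π ν (measurable_one.indicator hm)
  rw [lintegral_indicator_one hm] at h
  have h0 : ∀ (a : Fin T → Fin K) (x : Table K), playProb π x a *
      {ω : Table K × (Fin T → Fin K) | playProb π ω.1 ω.2 = 0}.indicator 1 (x, a) = 0 := by
    intro a x
    by_cases hx : playProb π x a = 0
    · rw [hx, zero_mul]
    · rw [Set.indicator_of_notMem (by exact hx), mul_zero]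
  simp only [h0, lintegral_zero, Finset.sum_const_zero] at h
  rw [ae_iff]
  simpa using h

theorem measurable_of_snd {K T : ℕ} {E : Type*} [MeasurableSpace E] (F : (Fin T → Fin K) → E) :
    Measurable fun ω : Table K × (Fin T → Fin K) => F ω.2 :=
  (measurable_of_countable F).comp measurable_snd

theorem memLp_of_snd {K T : ℕ} (π : Policy K T) (ν : Instance K)
    (F : (Fin T → Fin K) → ℝ) (p : ℝ≥0∞) : MemLp (fun ω => F ω.2) p (runLaw π ν) := by
  refine MemLp.of_bound (measurable_of_snd F).aestronglyMeasurable (∑ a, ‖F a‖)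
    (ae_of_all _ fun ω => ?_)
  exact Finset.single_le_sum (f := fun a => ‖F a‖) (fun _ _ => norm_nonneg _)
    (Finset.mem_univ ω.2)

end MAB

/-! ### Chapman–Robbins inequality for runs -/

theorem ProbabilityTheory.sq_covariance_le {Ω : Type*} {mΩ : MeasurableSpace Ω} {μ : Measure Ω}
    [IsProbabilityMeasure μ] {X Y : Ω → ℝ} (hX : MemLp X 2 μ) (hY : MemLp Y 2 μ) :
    cov[X, Y; μ] ^ 2 ≤ Var[X; μ] * Var[Y; μ] := by
  -- This quadratic is the variance of `X + s Y`; its discriminant is nonpositive.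
  have h : ∀ s : ℝ, 0 ≤ Var[Y; μ] * (s * s) + 2 * cov[X, Y; μ] * s + Var[X; μ] := by
    intro s
    have h1 := variance_add hX (hY.const_mul s)
    rw [variance_const_mul, covariance_const_mul_right] at h1
    have h2 := variance_nonneg (X + fun ω => s * Y ω) μ
    nlinarith
  have := discrim_le_zero h
  unfold discrim at this
  nlinarith

namespace MAB

/-- Given the table, the playing probabilities do not depend on the instance, and they read only the
first `T` entries of each row. The likelihood ratio can therefore be taken over all these entries,
seen or not, which keeps its factors independent. -/
theorem lintegral_runLaw_snd_withDensity {K T : ℕ} (π : Policy K T) {ν ν' : Instance K}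
    {l : Fin K → ℝ → ℝ≥0∞} (hl : ∀ i, Measurable (l i))
    (h : ∀ i, (ν' i : Measure ℝ) = (ν i : Measure ℝ).withDensity (l i))
    (g : (Fin T → Fin K) → ℝ≥0∞) :
    ∫⁻ ω, g ω.2 ∂(runLaw π ν') =
      ∫⁻ ω, (∏ p ∈ Finset.univ ×ˢ Finset.range T, l p.1 (ω.1 p)) * g ω.2 ∂(runLaw π ν) := by
  have hL : Measurable fun x : Table K => ∏ p ∈ Finset.univ ×ˢ Finset.range T, l p.1 (x p) :=
    Finset.measurable_prod _ fun p _ => (hl p.1).comp (measurable_pi_apply p)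
  rw [lintegral_runLaw π ν' (measurable_of_snd g), lintegral_runLaw π ν
    (g := fun ω => (∏ p ∈ Finset.univ ×ˢ Finset.range T, l p.1 (ω.1 p)) * g ω.2)
    ((hL.comp measurable_fst).mul (measurable_of_snd g))]
  refine Finset.sum_congr rfl fun a _ => ?_
  have := Measure.lintegral_infinitePi_withDensity
    (μ := fun p : Fin K × ℕ => (ν p.1 : Measure ℝ)) (μ' := fun p => (ν' p.1 : Measure ℝ))
    (l := fun p => l p.1) (fun p => hl p.1) (fun p => h p.1)
    (Finset.univ ×ˢ Finset.range T) (g := fun x => playProb π x a * g a)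
    ((measurable_playProb π a).mul_const _) (fun x y hxy => by rw [playProb_congr π a hxy])
  unfold tableLaw
  rw [this]
  exact lintegral_congr fun x => by ring

/-- A Chapman–Robbins bound: the mean of a statistic of the actions under an instance with
bounded likelihood ratios `l i` is controlled by its variance under the base instance. -/
theorem sq_integral_sub_integral_le {K T : ℕ} (π : Policy K T) {ν ν' : Instance K}
    {l : Fin K → ℝ → ℝ} (hl : ∀ i, Measurable (l i)) (hl0 : ∀ i x, 0 ≤ l i x) {B : ℝ}
    (hlB : ∀ i x, l i x ≤ B)
    (h : ∀ i, (ν' i : Measure ℝ) = (ν i : Measure ℝ).withDensity (fun x => ENNReal.ofReal (l i x)))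
    (F : (Fin T → Fin K) → ℝ) :
    ((∫ ω, F ω.2 ∂(runLaw π ν')) - ∫ ω, F ω.2 ∂(runLaw π ν)) ^ 2 ≤
      Var[fun ω => F ω.2; runLaw π ν] * ((∏ i, ∫ x, l i x ^ 2 ∂(ν i : Measure ℝ)) ^ T - 1) := by
  set S : Finset (Fin K × ℕ) := Finset.univ ×ˢ Finset.range T with hS
  set Lt : Table K → ℝ := fun x => ∏ p ∈ S, l p.1 (x p) with hLt
  set L : Table K × (Fin T → Fin K) → ℝ := fun ω => Lt ω.1 with hLdef
  have hLtm : Measurable Lt :=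
    Finset.measurable_prod _ fun p _ => (hl p.1).comp (measurable_pi_apply p)
  have hLm : Measurable L := hLtm.comp measurable_fst
  have hL0 : ∀ ω, 0 ≤ L ω := fun ω => Finset.prod_nonneg fun p _ => hl0 _ _
  have hLB : ∀ ω, ‖L ω‖ ≤ B ^ S.card := fun ω => by
    rw [Real.norm_of_nonneg (hL0 ω), ← Finset.prod_const]
    exact Finset.prod_le_prod (fun p _ => hl0 _ _) fun p _ => hlB _ _
  have hmem : MemLp L 2 (runLaw π ν) :=
    MemLp.of_bound hLm.aestronglyMeasurable _ (ae_of_all _ hLB)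
  have hchange : ∀ G : (Fin T → Fin K) → ℝ,
      ∫ ω, G ω.2 ∂(runLaw π ν') = ∫ ω, L ω * G ω.2 ∂(runLaw π ν) := by
    intro G
    have hmap : (runLaw π ν').map Prod.snd
        = ((runLaw π ν).withDensity fun ω => ENNReal.ofReal (L ω)).map Prod.snd := by
      ext s hs
      rw [← lintegral_indicator_one hs, ← lintegral_indicator_one hs,
        lintegral_map (measurable_one.indicator hs) measurable_snd,
        lintegral_map (measurable_one.indicator hs) measurable_snd,
        lintegral_runLaw_snd_withDensity π (fun i => (hl i).ennreal_ofReal) h]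
      refine Eq.trans ?_ (lintegral_withDensity_eq_lintegral_mul _ hLm.ennreal_ofReal
        ((measurable_one.indicator hs).comp measurable_snd)).symm
      refine lintegral_congr fun ω => ?_
      simp only [Pi.mul_apply, Function.comp, hLdef, hLt]
      rw [ENNReal.ofReal_prod_of_nonneg fun p _ => hl0 _ _]
    have hGm : AEStronglyMeasurable G ((runLaw π ν').map Prod.snd) :=
      (measurable_of_countable G).aestronglyMeasurable
    rw [← integral_map measurable_snd.aemeasurable hGm, hmap,
      integral_map measurable_snd.aemeasurable (hmap ▸ hGm),
      integral_withDensity_eq_integral_toReal_smul hLm.ennreal_ofReal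
        (ae_of_all _ fun _ => ENNReal.ofReal_lt_top)]
    refine integral_congr_ae (ae_of_all _ fun ω => ?_)
    simp only [ENNReal.toReal_ofReal (hL0 ω), smul_eq_mul]
  have hL1 : ∫ ω, L ω ∂(runLaw π ν) = 1 := by
    have := hchange fun _ => 1
    simpa using this.symm
  have hF2 := memLp_of_snd π ν F 2
  -- The likelihood ratio has mean `1`, so the difference of means is a covariance with it and
  -- Cauchy–Schwarz applies.
  have hcov : (∫ ω, F ω.2 ∂(runLaw π ν')) - ∫ ω, F ω.2 ∂(runLaw π ν)
      = cov[fun ω => F ω.2, L; runLaw π ν] := by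
    rw [covariance_eq_sub hF2 hmem, hL1, mul_one, hchange F]
    congr 1
    exact integral_congr_ae (ae_of_all _ fun ω => mul_comm _ _)
  have hL2 : ∫ ω, L ω ^ 2 ∂(runLaw π ν) = (∏ i, ∫ x, l i x ^ 2 ∂(ν i : Measure ℝ)) ^ T := by
    have e1 : ∫ ω, L ω ^ 2 ∂(runLaw π ν) = ∫ x, Lt x ^ 2 ∂(tableLaw ν) := by
      rw [← map_fst_runLaw π ν, integral_map measurable_fst.aemeasurable
        (hLtm.pow_const 2).aestronglyMeasurable]
    have hind : iIndepFun (fun (p : S) (x : Table K) => l p.1.1 (x p.1) ^ 2) (tableLaw ν) :=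
      (iIndepFun_infinitePi (P := fun p : Fin K × ℕ => (ν p.1 : Measure ℝ))
        (X := fun p x => l p.1 x ^ 2) fun p => (hl p.1).pow_const 2).precomp
          Subtype.val_injective
    have e2 : ∀ x, Lt x ^ 2 = ∏ p : S, l p.1.1 (x p.1) ^ 2 := fun x => by
      simp only [hLt]
      rw [← Finset.prod_pow, ← Finset.prod_coe_sort]
    rw [e1]
    simp_rw [e2]
    rw [hind.integral_fun_prod_eq_prod_integral fun p =>
      (((hl _).comp (measurable_pi_apply _)).pow_const 2).aestronglyMeasurable]
    have e3 : ∀ p : Fin K × ℕ, ∫ x : Table K, l p.1 (x p) ^ 2 ∂(tableLaw ν)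
        = ∫ y, l p.1 y ^ 2 ∂(ν p.1 : Measure ℝ) := fun p => by
      have := Measure.infinitePi_map_eval (fun p : Fin K × ℕ => (ν p.1 : Measure ℝ)) p
      rw [← this, integral_map (measurable_pi_apply p).aemeasurable
        ((hl _).pow_const 2).aestronglyMeasurable]
      rfl
    simp_rw [e3]
    rw [Finset.prod_coe_sort S (fun p => ∫ y, l p.1 y ^ 2 ∂(ν p.1 : Measure ℝ)), hS,
      Finset.prod_product, ← Finset.prod_pow]
    simp
  have hvar : Var[L; runLaw π ν] = (∏ i, ∫ x, l i x ^ 2 ∂(ν i : Measure ℝ)) ^ T - 1 := by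
    rw [variance_eq_sub hmem, hL1, one_pow, ← hL2]
    rfl
  rw [hcov, ← hvar]
  exact sq_covariance_le hF2 hmem

end MAB

namespace MAB

/-! ### Two-point rewards -/

noncomputable def coinMeasure (σ p : ℝ) : Measure ℝ :=
  ENNReal.ofReal p • Measure.dirac σ + ENNReal.ofReal (1 - p) • Measure.dirac (-σ)

instance isProbabilityMeasure_coinMeasure (σ : ℝ) (p : unitInterval) :
    IsProbabilityMeasure (coinMeasure σ p) := by
  constructor
  simp only [coinMeasure, Measure.coe_add, Measure.coe_smul, Pi.add_apply, Pi.smul_apply,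
    measure_univ, smul_eq_mul, mul_one]
  rw [← ENNReal.ofReal_add p.2.1 (by linarith [p.2.2])]
  simp

theorem integral_coinMeasure (σ : ℝ) (p : unitInterval) (f : ℝ → ℝ) :
    ∫ x, f x ∂(coinMeasure σ p) = p * f σ + (1 - p) * f (-σ) := by
  unfold coinMeasure
  rw [integral_add_measure
    ((integrable_dirac (by simp)).smul_measure ENNReal.ofReal_ne_top)
    ((integrable_dirac (by simp)).smul_measure ENNReal.ofReal_ne_top),
    integral_smul_measure, integral_smul_measure, integral_dirac, integral_dirac,
    ENNReal.toReal_ofReal p.2.1, ENNReal.toReal_ofReal (by linarith [p.2.2])]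
  rfl

/-- The distribution on `{σ, -σ}` that charges `σ` with probability `p`. -/
noncomputable def coin (σ : ℝ) (p : unitInterval) : ProbabilityMeasure ℝ :=
  ⟨coinMeasure σ p, inferInstance⟩

/-- Hoeffding's lemma on an interval of length `2σ` gives exactly the parameter `σ²`. -/
theorem hasSubgaussianMGF_coin {σ : ℝ} (hσ : 0 < σ) (p : unitInterval) :
    HasSubgaussianMGF (fun x : ℝ => x - ∫ y, y ∂(coin σ p : Measure ℝ)) (σ ^ 2).toNNReal
      (coin σ p : Measure ℝ) := by
  have h : ∀ᵐ x ∂(coinMeasure σ p), x ∈ Set.Icc (-σ) σ := by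
    rw [ae_iff]
    simp [coinMeasure, hσ.le]
  have := hasSubgaussianMGF_of_mem_Icc (μ := coinMeasure σ p) (X := fun x => x)
    measurable_id.aemeasurable h
  convert! this using 1
  apply NNReal.eq
  rw [Real.coe_toNNReal _ (sq_nonneg σ)]
  push_cast
  rw [Real.norm_of_nonneg (by linarith)]
  ring

/-- The likelihood ratio of two distributions on `{σ, -σ}`. -/
noncomputable def coinRatio (σ p p' x : ℝ) : ℝ := if x = σ then p' / p else (1 - p') / (1 - p)

theorem measurable_coinRatio (σ p p' : ℝ) : Measurable (coinRatio σ p p') :=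
  Measurable.ite (measurableSet_singleton σ) measurable_const measurable_const

theorem coinRatio_nonneg (σ : ℝ) (p p' : unitInterval) (x : ℝ) : 0 ≤ coinRatio σ p p' x := by
  unfold coinRatio
  split_ifs
  · exact div_nonneg p'.2.1 p.2.1
  · exact div_nonneg (by linarith [p'.2.2]) (by linarith [p.2.2])

theorem coinRatio_le (σ : ℝ) {p p' : unitInterval} (hp : (p : ℝ) ∈ Set.Icc (1 / 4 : ℝ) (3 / 4))
    (x : ℝ) : coinRatio σ p p' x ≤ 4 := by
  unfold coinRatio
  have h1 := p'.2.1
  have h2 := p'.2.2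
  have h3 := hp.1
  have h4 := hp.2
  split_ifs
  · rw [div_le_iff₀ (by linarith)]; linarith
  · rw [div_le_iff₀ (by linarith)]; linarith

theorem coin_eq_withDensity {σ : ℝ} (hσ : 0 < σ) {p p' : unitInterval}
    (hp : (p : ℝ) ∈ Set.Icc (1 / 4 : ℝ) (3 / 4)) :
    (coin σ p' : Measure ℝ) =
      (coin σ p : Measure ℝ).withDensity fun x => ENNReal.ofReal (coinRatio σ p p' x) := by
  have h3 := hp.1
  have h4 := hp.2
  change coinMeasure σ p' = (coinMeasure σ p).withDensity _
  have hne : -σ ≠ σ := by linarith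
  unfold coinMeasure
  rw [withDensity_add_measure, withDensity_smul_measure, withDensity_smul_measure,
    dirac_withDensity, dirac_withDensity, smul_smul, smul_smul,
    ← ENNReal.ofReal_mul (by linarith), ← ENNReal.ofReal_mul (by linarith)]
  simp only [coinRatio, if_true, if_neg hne]
  rw [mul_div_cancel₀ _ (by linarith), mul_div_cancel₀ _ (by linarith)]

/-- The χ² divergence of the coins is `(p' - p)² / (p (1 - p))`, and `p (1 - p) ≥ 3/16` on `[1/4,
3/4]`. -/
theorem integral_coinRatio_sq {σ : ℝ} (hσ : 0 < σ) {p p' : unitInterval}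
    (hp : (p : ℝ) ∈ Set.Icc (1 / 4 : ℝ) (3 / 4)) :
    ∫ x, coinRatio σ p p' x ^ 2 ∂(coin σ p : Measure ℝ) ≤ 1 + 16 / 3 * ((p' : ℝ) - p) ^ 2 := by
  have h3 := hp.1
  have h4 := hp.2
  have hne : -σ ≠ σ := by linarith
  change ∫ x, coinRatio σ p p' x ^ 2 ∂(coinMeasure σ p) ≤ _
  rw [integral_coinMeasure]
  simp only [coinRatio, if_true, if_neg hne]
  have e : (p : ℝ) * ((p' : ℝ) / p) ^ 2 + (1 - p) * ((1 - (p' : ℝ)) / (1 - p)) ^ 2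
      = 1 + (p' - p) ^ 2 / (p * (1 - p)) := by
    have : (1 - (p : ℝ)) ≠ 0 := by linarith
    have : (p : ℝ) ≠ 0 := by linarith
    field_simp
    ring
  rw [e]
  have hpp : 3 / 16 ≤ (p : ℝ) * (1 - p) := by nlinarith
  have : ((p' : ℝ) - p) ^ 2 / (p * (1 - p)) ≤ 16 / 3 * ((p' : ℝ) - p) ^ 2 := by
    rw [div_le_iff₀ (by linarith)]
    nlinarith [sq_nonneg ((p' : ℝ) - p)]
  linarith

/-- The instance whose first arm has mean `0` and whose second arm has mean `σ z`. -/
noncomputable def coinPair (σ z : ℝ) : Instance 2 :=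
  ![coin σ (Set.projIcc 0 1 zero_le_one (1 / 2)),
    coin σ (Set.projIcc 0 1 zero_le_one ((1 + z) / 2))]

theorem coe_projIcc_of_mem {x : ℝ} (hx : x ∈ Set.Icc (0 : ℝ) 1) :
    (Set.projIcc (0 : ℝ) 1 zero_le_one x : ℝ) = x := by
  rw [Set.projIcc_of_mem zero_le_one hx]

theorem mean_coinPair_zero (σ z : ℝ) : mean (coinPair σ z) 0 = 0 := by
  change ∫ x, x ∂(coinMeasure σ _) = 0
  rw [integral_coinMeasure, coe_projIcc_of_mem (by norm_num)]
  ring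

theorem mean_coinPair_one (σ : ℝ) {z : ℝ} (hz : |z| ≤ 1) : mean (coinPair σ z) 1 = σ * z := by
  obtain ⟨h1, h2⟩ := abs_le.1 hz
  change ∫ x, x ∂(coinMeasure σ _) = σ * z
  rw [integral_coinMeasure, coe_projIcc_of_mem ⟨by linarith, by linarith⟩]
  ring

theorem isSubGaussianInstance_coinPair {M σ z : ℝ} (hM : 0 < M) (hσ : 0 < σ) (hz : |z| ≤ 1)
    (hzM : σ * |z| ≤ M) : IsSubGaussianInstance M σ (coinPair σ z) := by
  intro i
  constructor
  · fin_cases i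
    · simp [mean_coinPair_zero, hM.le]
    · simp only [Fin.mk_one, mean_coinPair_one σ hz]
      rw [← abs_of_pos hσ, ← abs_mul, abs_le] at hzM
      exact hzM
  · fin_cases i <;> exact hasSubgaussianMGF_coin hσ _

theorem gap_fin_two (ν : Instance 2) (i : Fin 2) :
    gap ν i = max (mean ν 0) (mean ν 1) - mean ν i := by
  unfold gap
  congr 1
  refine le_antisymm (ciSup_le fun j => ?_) (max_le ?_ ?_)
  · fin_cases j
    · exact le_max_left _ _
    · exact le_max_right _ _
  · exact le_ciSup (f := mean ν) (Set.finite_range _).bddAbove 0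
  · exact le_ciSup (f := mean ν) (Set.finite_range _).bddAbove 1

theorem pullCount_zero_eq {T : ℕ} (ω : Table 2 × (Fin T → Fin 2)) :
    pullCount 0 ω = T - pullCount 1 ω := by
  have := pulls_fin_two ω.2 le_rfl (i := 0) (j := 1) (by decide)
  unfold pullCount
  rw [eq_sub_iff_add_eq]
  exact_mod_cast this

theorem memLp_pullCount {K T : ℕ} (π : Policy K T) (ν : Instance K) (i : Fin K) :
    MemLp (pullCount i) 2 (runLaw π ν) :=
  memLp_of_snd π ν (fun a => (pulls a i T : ℝ)) 2

/-- The regret is `σ |z|` times the count of the worse arm, and the two counts have the same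
variance since they add up to `T`. -/
theorem regretSD_coinPair {T : ℕ} (π : Policy 2 T) {σ z : ℝ} (hσ : 0 < σ) (hz : |z| ≤ 1) :
    regretSD π (coinPair σ z) =
      σ * |z| * √(Var[pullCount 1; runLaw π (coinPair σ z)]) := by
  have key : Var[pseudoRegret (coinPair σ z); runLaw π (coinPair σ z)]
      = (σ * |z|) ^ 2 * Var[pullCount 1; runLaw π (coinPair σ z)] := by
    have hR : pseudoRegret (T := T) (coinPair σ z) = fun ω =>
        (max 0 (σ * z)) * (T - pullCount 1 ω) + (max 0 (σ * z) - σ * z) * pullCount 1 ω := by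
      funext ω
      simp [pseudoRegret, Fin.sum_univ_two, gap_fin_two, mean_coinPair_zero,
        mean_coinPair_one σ hz, pullCount_zero_eq]
    rw [hR]
    rcases le_total 0 z with h | h
    · rw [max_eq_right (by positivity), abs_of_nonneg h]
      simp only [sub_self, zero_mul, add_zero]
      rw [variance_const_mul, variance_const_sub (memLp_pullCount _ _ _).aestronglyMeasurable]
    · rw [max_eq_left (mul_nonpos_of_nonneg_of_nonpos hσ.le h), abs_of_nonpos h]
      simp only [zero_mul, zero_add, zero_sub]
      rw [variance_const_mul]
      ring
  unfold regretSD
  rw [key, Real.sqrt_mul (sq_nonneg _), Real.sqrt_sq (by positivity)]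

theorem expectedRegret_coinPair {T : ℕ} (π : Policy 2 T) {σ z : ℝ} (hz : |z| ≤ 1) :
    expectedRegret π (coinPair σ z) =
      (max 0 (σ * z)) * (T - ∫ ω, pullCount 1 ω ∂(runLaw π (coinPair σ z)))
        + (max 0 (σ * z) - σ * z) * ∫ ω, pullCount 1 ω ∂(runLaw π (coinPair σ z)) := by
  have h0 : ∫ ω, pullCount 0 ω ∂(runLaw π (coinPair σ z))
      = T - ∫ ω, pullCount 1 ω ∂(runLaw π (coinPair σ z)) := by
    simp_rw [pullCount_zero_eq]
    rw [integral_sub (integrable_const _) ((memLp_pullCount _ _ _).integrable (by norm_num))]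
    simp
  simp [expectedRegret, Fin.sum_univ_two, gap_fin_two, mean_coinPair_zero,
    mean_coinPair_one σ hz, h0]

/-! ### The lower bound -/

theorem abs_integral_pullCount_sub_le {T : ℕ} (π : Policy 2 T) {σ z z' : ℝ} (hσ : 0 < σ)
    (hz : |z| ≤ 1 / 2) (hz' : |z'| ≤ 1 / 2) (hzz : (z' - z) ^ 2 * T ≤ 1 / 4) :
    |(∫ ω, pullCount 1 ω ∂(runLaw π (coinPair σ z')))
        - ∫ ω, pullCount 1 ω ∂(runLaw π (coinPair σ z))|
      ≤ √(Var[pullCount 1; runLaw π (coinPair σ z)]) := by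
  obtain ⟨h1, h2⟩ := abs_le.1 hz
  obtain ⟨h3, h4⟩ := abs_le.1 hz'
  set P : ℝ → Fin 2 → unitInterval := fun z => ![Set.projIcc 0 1 zero_le_one (1 / 2),
    Set.projIcc 0 1 zero_le_one ((1 + z) / 2)] with hP
  have hP0 : ∀ z, (P z 0 : ℝ) = 1 / 2 := fun z => coe_projIcc_of_mem (by norm_num)
  have hP1 : ∀ z, |z| ≤ 1 / 2 → (P z 1 : ℝ) = (1 + z) / 2 := fun z h => by
    obtain ⟨h1, h2⟩ := abs_le.1 h
    exact coe_projIcc_of_mem ⟨by linarith, by linarith⟩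
  have hpair : ∀ z i, coinPair σ z i = coin σ (P z i) := fun z i => by fin_cases i <;> rfl
  have hmem : ∀ i, (P z i : ℝ) ∈ Set.Icc (1 / 4 : ℝ) (3 / 4) := by
    intro i
    fin_cases i
    · simp only [Fin.zero_eta, hP0]; norm_num
    · simp only [Fin.mk_one, hP1 z hz]
      exact ⟨by linarith, by linarith⟩
  have hCR := sq_integral_sub_integral_le π (ν := coinPair σ z) (ν' := coinPair σ z')
    (l := fun i => coinRatio σ (P z i) (P z' i)) (fun i => measurable_coinRatio _ _ _)
    (fun i => coinRatio_nonneg _ _ _) (fun i => coinRatio_le σ (hmem i))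
    (fun i => by rw [hpair, hpair]; exact coin_eq_withDensity hσ (hmem i))
    (fun a => (pulls a 1 T : ℝ))
  -- The first arm has the same law in both instances and contributes `1`; the second contributes at
  -- most `exp (4/3 (z' - z)² T)`, with exponent at most `1/3`.
  have hprod : (∏ i, ∫ x, coinRatio σ (P z i) (P z' i) x ^ 2 ∂(coinPair σ z i : Measure ℝ)) ^ T
      ≤ 2 := by
    have hb := fun i => integral_coinRatio_sq (p' := P z' i) hσ (hmem i)
    have hn : ∀ i, 0 ≤ ∫ x, coinRatio σ (P z i) (P z' i) x ^ 2 ∂(coin σ (P z i) : Measure ℝ) :=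
      fun i => integral_nonneg fun x => sq_nonneg _
    simp_rw [hpair]
    rw [Fin.prod_univ_two]
    have hb0 := hb 0
    have hb1 := hb 1
    rw [hP0, hP0] at hb0
    rw [hP1 _ hz, hP1 _ hz'] at hb1
    have hb0' : ∫ x, coinRatio σ (P z 0) (P z' 0) x ^ 2 ∂(coin σ (P z 0) : Measure ℝ) ≤ 1 := by
      rw [hP0, hP0]; linarith
    have hb1' : ∫ x, coinRatio σ (P z 1) (P z' 1) x ^ 2 ∂(coin σ (P z 1) : Measure ℝ)
        ≤ Real.exp (4 / 3 * (z' - z) ^ 2) := by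
      rw [hP1 _ hz, hP1 _ hz']
      refine hb1.trans (le_trans (le_of_eq ?_) (Real.add_one_le_exp _))
      ring
    calc _ ≤ (1 * Real.exp (4 / 3 * (z' - z) ^ 2)) ^ T :=
          pow_le_pow_left₀ (mul_nonneg (hn 0) (hn 1))
            (mul_le_mul hb0' hb1' (hn 1) zero_le_one) _
      _ = Real.exp (T * (4 / 3 * (z' - z) ^ 2)) := by rw [one_mul, Real.exp_nat_mul]
      _ ≤ Real.exp (1 / 2) := Real.exp_le_exp.2 (by nlinarith)
      _ ≤ 2 := by
        rw [show (1 / 2 : ℝ) = 2⁻¹ * 1 by norm_num]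
        have := Real.exp_one_lt_d9
        have h4 : Real.exp (2⁻¹ * 1) ^ 2 = Real.exp 1 := by
          rw [← Real.exp_nat_mul]; norm_num
        nlinarith [Real.exp_pos (2⁻¹ * 1)]
  refine Real.abs_le_sqrt (hCR.trans ?_)
  have := variance_nonneg (fun ω : Table 2 × (Fin T → Fin 2) => (pulls ω.2 1 T : ℝ))
    (runLaw π (coinPair σ z))
  exact mul_le_of_le_one_right this (by linarith)

/-- Telescoping along the grid; the step bounds `C / k` add up to a harmonic number, the source of
the logarithm. -/
theorem abs_sub_zero_le_of_steps {u : ℝ → ℝ} {δ C : ℝ} {n : ℕ} (hn : 0 < n)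
    (hstep : ∀ k : ℕ, 1 ≤ k → k ≤ n →
      |u ((k - 1 : ℝ) * (δ / n)) - u (k * (δ / n))| ≤ C / k) (hC : 0 ≤ C) :
    |u δ - u 0| ≤ C * (1 + Real.log n) := by
  have h : ∀ m : ℕ, m ≤ n → |u (m * (δ / n)) - u 0| ≤ C * (harmonic m : ℚ) := by
    intro m
    induction m with
    | zero => simp
    | succ m ih =>
      intro hm
      have h1 := ih (by omega)
      have h2 := hstep (m + 1) (by omega) hm
      rw [harmonic_succ]
      push_cast at h2 ⊢
      rw [add_sub_cancel_right, abs_sub_comm] at h2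
      calc _ ≤ |u ((m + 1) * (δ / n)) - u (m * (δ / n))| + |u (m * (δ / n)) - u 0| :=
            abs_sub_le _ _ _
        _ ≤ C / (m + 1) + C * (harmonic m : ℚ) := add_le_add h2 h1
        _ = _ := by ring
  have h1 := h n le_rfl
  have hn' : (n : ℝ) ≠ 0 := by positivity
  rw [mul_div_cancel₀ _ hn'] at h1
  exact h1.trans (mul_le_mul_of_nonneg_left (harmonic_le_one_add_log n) hC)

theorem integral_pullCount_sub_le {T : ℕ} (hT : 4 ≤ T) (π : Policy 2 T) {σ δ S : ℝ} (hσ : 0 < σ)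
    (hδ : 0 < δ) (hδ' : δ ≤ 1 / 2)
    (hS : ∀ z, |z| ≤ δ → regretSD π (coinPair σ z) ≤ S) :
    (∫ ω, pullCount 1 ω ∂(runLaw π (coinPair σ δ)))
        - ∫ ω, pullCount 1 ω ∂(runLaw π (coinPair σ (-δ)))
      ≤ 8 * S * √T * Real.log T / (σ * δ) := by
  set u : ℝ → ℝ := fun z => ∫ ω, pullCount 1 ω ∂(runLaw π (coinPair σ z)) with hu
  have hT' : (4 : ℝ) ≤ T := by exact_mod_cast hT
  have hs2 : (2 : ℝ) ≤ √T := by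
    rw [show (2 : ℝ) = √4 by rw [show (4 : ℝ) = 2 ^ 2 by norm_num]; simp]
    exact Real.sqrt_le_sqrt hT'
  have hss : √(T : ℝ) * √T = T := Real.mul_self_sqrt (by positivity)
  -- A mesh `δ / n ≤ 1 / (2√T)` is what the one-step bound needs.
  set n : ℕ := ⌈√(T : ℝ)⌉₊ with hn
  have hn1 : √(T : ℝ) ≤ n := Nat.le_ceil _
  have hn2 : (n : ℝ) < √T + 1 := Nat.ceil_lt_add_one (Real.sqrt_nonneg _)
  have hnR : (0 : ℝ) < n := by linarith
  have hn0 : 0 < n := by exact_mod_cast hnR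
  have hS0 : 0 ≤ S := (Real.sqrt_nonneg _).trans (hS 0 (by simpa using hδ.le))
  have hlog1 : 1 ≤ Real.log T := by
    rw [Real.le_log_iff_exp_le (by linarith)]
    linarith [Real.exp_one_lt_d9]
  have hlogn : Real.log n ≤ Real.log T := Real.log_le_log hnR (by nlinarith)
  have hside : ∀ s : ℝ, |s| = 1 →
      |u (s * δ) - u 0| ≤ S * n / (σ * δ) * (1 + Real.log n) := by
    intro s hs
    refine abs_sub_zero_le_of_steps hn0 (fun k hk1 hkn => ?_) (by positivity)
    have hk1' : (1 : ℝ) ≤ k := by exact_mod_cast hk1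
    have hkn' : (k : ℝ) ≤ n := by exact_mod_cast hkn
    have habs : ∀ c : ℝ, 0 ≤ c → c ≤ n → |c * (s * δ / n)| ≤ δ := by
      intro c hc hcn
      rw [abs_mul, abs_div, abs_mul, hs, abs_of_pos hδ, abs_of_nonneg hc, abs_of_pos hnR, one_mul,
        mul_div_assoc', div_le_iff₀ hnR]
      nlinarith
    have hz := habs k (by linarith) hkn'
    have hz' := habs (k - 1) (by linarith) (by linarith)
    have hzabs : |k * (s * δ / n)| = k * δ / n := by
      rw [abs_mul, abs_div, abs_mul, hs, abs_of_pos hδ, abs_of_nonneg (by linarith : (0:ℝ) ≤ k),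
        abs_of_pos hnR, one_mul, mul_div_assoc']
    -- The variance is taken at the outer point `k`, never at `z = 0`, where the regret says nothing
    -- about the pull count.
    refine (abs_integral_pullCount_sub_le π hσ (hz.trans hδ') (hz'.trans hδ') ?_).trans ?_
    · have e : ((k - 1) * (s * δ / n) - k * (s * δ / n)) ^ 2 = δ ^ 2 / n ^ 2 := by
        have : s ^ 2 = 1 := by rw [← sq_abs, hs, one_pow]
        rw [show ((k - 1) * (s * δ / n) - k * (s * δ / n)) ^ 2 = s ^ 2 * (δ ^ 2 / n ^ 2) by ring,
          this, one_mul]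
      rw [e, div_mul_eq_mul_div, div_le_iff₀ (by positivity)]
      have : (T : ℝ) ≤ n ^ 2 := by nlinarith
      have : δ ^ 2 ≤ 1 / 4 := by nlinarith
      nlinarith [sq_nonneg δ]
    · have h1 := hS _ hz
      rw [regretSD_coinPair π hσ (by linarith), hzabs] at h1
      rw [div_div, le_div_iff₀ (by positivity)]
      have h2 := mul_le_mul_of_nonneg_right h1 hnR.le
      refine le_trans (le_of_eq ?_) h2
      field_simp
  have hp := hside 1 (by simp)
  have hm := hside (-1) (by simp)
  rw [one_mul] at hp
  rw [neg_one_mul] at hm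
  have hsum : u δ - u (-δ) ≤ 2 * (S * n / (σ * δ) * (1 + Real.log n)) := by
    linarith [le_abs_self (u δ - u 0), neg_abs_le (u (-δ) - u 0)]
  refine hsum.trans ?_
  rw [le_div_iff₀ (by positivity)]
  have e : 2 * (S * n / (σ * δ) * (1 + Real.log n)) * (σ * δ) = 2 * S * (n * (1 + Real.log n)) := by
    field_simp
  rw [e]
  have : (n : ℝ) * (1 + Real.log n) ≤ (2 * √T) * (2 * Real.log T) :=
    mul_le_mul (by linarith) (by linarith)
      (by linarith [Real.log_nonneg (show (1 : ℝ) ≤ n by linarith)]) (by positivity)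
  nlinarith [mul_le_mul_of_nonneg_left this (mul_nonneg zero_le_two hS0)]

theorem le_worstRegretSD {M σ : ℝ} {Kbar : ℕ} (alg : Algorithm) (T : ℕ) (hK : 2 ≤ Kbar)
    {ν : Instance 2} (hν : IsSubGaussianInstance M σ ν) :
    ENNReal.ofReal (regretSD (alg 2 le_rfl T) ν) ≤ worstRegretSD M σ Kbar alg T :=
  le_iSup_of_le 2 <| le_iSup_of_le le_rfl <| le_iSup_of_le hK <| le_iSup_of_le ν <|
    le_iSup_of_le hν le_rfl

theorem le_worstRegret {M σ : ℝ} {Kbar : ℕ} (alg : Algorithm) (T : ℕ) (hK : 2 ≤ Kbar)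
    {ν : Instance 2} (hν : IsSubGaussianInstance M σ ν) :
    ENNReal.ofReal (expectedRegret (alg 2 le_rfl T) ν) ≤ worstRegret M σ Kbar alg T :=
  le_iSup_of_le 2 <| le_iSup_of_le le_rfl <| le_iSup_of_le hK <| le_iSup_of_le ν <|
    le_iSup_of_le hν le_rfl

theorem exists_lt_liminf_worstRegretSD {M σ : ℝ} (hM : 0 < M) (hσ : 0 < σ) {Kbar : ℕ}
    (hK : 2 ≤ Kbar) :
    ∃ c : ℝ, 0 < c ∧ ∀ alg : Algorithm, IsActiveLearning M σ Kbar alg →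
      ENNReal.ofReal c < liminf (fun T : ℕ =>
        ENNReal.ofReal (Real.log T / √(T : ℝ)) * worstRegretSD M σ Kbar alg T) atTop := by
  set δ : ℝ := min (M / σ) (1 / 2) with hδdef
  have hδ : 0 < δ := lt_min (by positivity) (by norm_num)
  have hδ' : δ ≤ 1 / 2 := min_le_right _ _
  have hδM : σ * δ ≤ M := by
    have : δ ≤ M / σ := min_le_left _ _
    rw [le_div_iff₀ hσ] at this
    linarith
  have hsub : ∀ z, |z| ≤ δ → IsSubGaussianInstance M σ (coinPair σ z) := fun z hz =>
    isSubGaussianInstance_coinPair hM hσ (by linarith)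
      ((mul_le_mul_of_nonneg_left hz hσ.le).trans hδM)
  have hpos : 0 < σ * δ := by positivity
  -- The argument gives `σ δ / 16` eventually; halving makes the inequality for the liminf strict.
  refine ⟨σ * δ / 32, by positivity, fun alg halg => ?_⟩
  refine lt_of_lt_of_le ((ENNReal.ofReal_lt_ofReal_iff (by positivity)).2
    (show σ * δ / 32 < σ * δ / 16 by linarith)) (le_liminf_of_le (by isBoundedDefault) ?_)
  -- Regret at most `σ δ T / 4` at `z = ±δ` means that the worse arm takes at most `T / 4` pulls on
  -- average, hence `u δ - u (-δ) ≥ T / 2`.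
  have hev := halg.eventually (gt_mem_nhds (ENNReal.ofReal_pos.2
    (show 0 < σ * δ / 4 by positivity)))
  filter_upwards [hev, eventually_ge_atTop 4] with T hTr hT
  have hT' : (4 : ℝ) ≤ T := by exact_mod_cast hT
  by_contra! hlt
  have hlog : 0 < Real.log T := Real.log_pos (by linarith)
  have hsq : 0 < √(T : ℝ) := Real.sqrt_pos.2 (by linarith)
  have hfac : 0 < Real.log T / √(T : ℝ) := by positivity
  have hfin : worstRegretSD M σ Kbar alg T ≠ ⊤ := by
    intro htop
    rw [htop, ENNReal.mul_top (by simpa using hfac)] at hlt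
    exact not_top_lt hlt
  set S := (worstRegretSD M σ Kbar alg T).toReal with hSdef
  have hS : ∀ z, |z| ≤ δ → regretSD (alg 2 le_rfl T) (coinPair σ z) ≤ S := fun z hz =>
    (ENNReal.ofReal_le_iff_le_toReal hfin).1 (le_worstRegretSD alg T hK (hsub z hz))
  rw [← ENNReal.ofReal_toReal hfin, ← ENNReal.ofReal_mul hfac.le,
    ENNReal.ofReal_lt_ofReal_iff (by positivity)] at hlt
  have hER : ∀ z, |z| ≤ δ → expectedRegret (alg 2 le_rfl T) (coinPair σ z) ≤ σ * δ / 4 * T := by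
    intro z hz
    have h1 := le_worstRegret alg T hK (hsub z hz)
    rw [ENNReal.div_lt_iff (by left; positivity) (by left; simp)] at hTr
    have h2 := h1.trans hTr.le
    rw [← ENNReal.ofReal_natCast, ← ENNReal.ofReal_mul (by positivity)] at h2
    exact (ENNReal.ofReal_le_ofReal_iff (by positivity)).1 h2
  have hmain := integral_pullCount_sub_le hT (alg 2 le_rfl T) hσ hδ hδ' hS
  have h1 := hER δ (by rw [abs_of_pos hδ])
  have h2 := hER (-δ) (by rw [abs_neg, abs_of_pos hδ])
  rw [expectedRegret_coinPair _ (by rw [abs_of_pos hδ]; linarith)] at h1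
  rw [expectedRegret_coinPair _ (by rw [abs_neg, abs_of_pos hδ]; linarith)] at h2
  rw [max_eq_right hpos.le, sub_self, zero_mul, add_zero] at h1
  rw [max_eq_left (by linarith), zero_mul, zero_add] at h2
  rw [le_div_iff₀ hpos] at hmain
  have h3 : S * Real.log T < σ * δ / 16 * √T := by
    have : Real.log T / √(T : ℝ) * S = S * Real.log T / √T := by ring
    rw [this, div_lt_iff₀ hsq] at hlt
    exact hlt
  have hss : √(T : ℝ) * √T = T := Real.mul_self_sqrt (by positivity)
  have h4 := mul_lt_mul_of_pos_right h3 (show 0 < 8 * √(T : ℝ) by positivity)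
  have h5 : σ * δ / 16 * √(T : ℝ) * (8 * √T) = σ * δ * T / 2 := by
    linear_combination (σ * δ / 2) * hss
  nlinarith

end MAB

namespace MAB

/-! ### Concentration of the reward table -/

/-- The first `T` partial sums of each row of the table deviate from their means by at most `b`
times the root of the number of terms. -/
def concentrationSet {K : ℕ} (ν : Instance K) (T : ℕ) (b : ℝ) : Set (Table K) :=
  {x | ∀ i, ∀ n ∈ Finset.Icc 1 T, |∑ s ∈ Finset.range n, (x (i, s) - mean ν i)| ≤ b * √(n : ℝ)}

theorem measurable_sum_row {K : ℕ} (i : Fin K) (n : ℕ) (c : ℝ) :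
    Measurable fun x : Table K => ∑ s ∈ Finset.range n, (x (i, s) - c) :=
  Finset.measurable_sum _ fun _ _ => (measurable_pi_apply _).sub_const _

theorem measurableSet_concentrationSet {K : ℕ} (ν : Instance K) (T : ℕ) (b : ℝ) :
    MeasurableSet (concentrationSet ν T b) := by
  unfold concentrationSet
  simp only [Set.ofPred_forall]
  exact MeasurableSet.iInter fun i => MeasurableSet.iInter fun n => MeasurableSet.iInter fun _ =>
    measurableSet_le (measurable_sum_row i n _).abs measurable_const

theorem hasSubgaussianMGF_sum_row {M σ : ℝ} {K : ℕ} {ν : Instance K}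
    (hν : IsSubGaussianInstance M σ ν) (i : Fin K) (n : ℕ) :
    HasSubgaussianMGF (fun x : Table K => ∑ s ∈ Finset.range n, (x (i, s) - mean ν i))
      (n * (σ ^ 2).toNNReal) (tableLaw ν) := by
  have hind : iIndepFun (fun (s : ℕ) (x : Table K) => x (i, s) - mean ν i) (tableLaw ν) :=
    (iIndepFun_infinitePi (P := fun p : Fin K × ℕ => (ν p.1 : Measure ℝ))
      (X := fun p y => y - mean ν i) fun p => measurable_id.sub_const _).precomp
        (g := fun s : ℕ => (i, s)) (Prod.mk_right_injective i)
  have hs : ∀ s, HasSubgaussianMGF (fun x : Table K => x (i, s) - mean ν i)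
      (σ ^ 2).toNNReal (tableLaw ν) := by
    intro s
    have h := (hν i).2
    have hmap := Measure.infinitePi_map_eval (fun p : Fin K × ℕ => (ν p.1 : Measure ℝ)) (i, s)
    simp only at hmap
    rw [← hmap] at h
    exact HasSubgaussianMGF.of_map (Y := fun x : Table K => x (i, s))
      (measurable_pi_apply (i, s)).aemeasurable h
  have := HasSubgaussianMGF.sum_of_iIndepFun hind (c := fun _ => (σ ^ 2).toNNReal)
    (s := Finset.range n) fun s _ => hs s
  simpa using this

/-- Union bound over rows, lengths and signs. Scaling the threshold by `√n` makes the sub-Gaussian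
tail independent of `n`. Working on the table avoids random pull counts. -/
theorem measureReal_compl_concentrationSet_le {M σ : ℝ} (hσ : 0 < σ) {K : ℕ} {ν : Instance K}
    (hν : IsSubGaussianInstance M σ ν) (T : ℕ) {b : ℝ} (hb : 0 ≤ b) :
    (tableLaw ν).real (concentrationSet ν T b)ᶜ ≤ K * (T * (2 * Real.exp (-b ^ 2 / (2 * σ ^ 2)))) := by
  set Z : Fin K → ℕ → Table K → ℝ :=
    fun i n x => ∑ s ∈ Finset.range n, (x (i, s) - mean ν i) with hZ
  have hsub : (concentrationSet ν T b)ᶜ ⊆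
      ⋃ i ∈ Finset.univ, ⋃ n ∈ Finset.Icc 1 T,
        ({x | b * √(n : ℝ) ≤ Z i n x} ∪ {x | b * √(n : ℝ) ≤ (-Z i n) x}) := by
    intro x hx
    simp only [concentrationSet, Set.mem_compl_iff, Set.mem_ofPred_eq, not_forall, not_le] at hx
    obtain ⟨i, n, hn, hlt⟩ := hx
    simp only [Set.mem_iUnion]
    refine ⟨i, Finset.mem_univ i, n, hn, ?_⟩
    rcases lt_abs.1 hlt with h | h
    · exact Or.inl h.le
    · exact Or.inr h.le
  have hexp : ∀ n ∈ Finset.Icc 1 T,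
      -(b * √(n : ℝ)) ^ 2 / (2 * ((n * (σ ^ 2).toNNReal : NNReal) : ℝ)) = -b ^ 2 / (2 * σ ^ 2) := by
    intro n hn
    have hn1 : (0 : ℝ) < n := by exact_mod_cast (Finset.mem_Icc.1 hn).1
    push_cast
    rw [Real.coe_toNNReal _ (sq_nonneg σ), mul_pow, Real.sq_sqrt hn1.le]
    field_simp
  have hone : ∀ i, ∀ n ∈ Finset.Icc 1 T, (tableLaw ν).real
      ({x | b * √(n : ℝ) ≤ Z i n x} ∪ {x | b * √(n : ℝ) ≤ (-Z i n) x})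
      ≤ 2 * Real.exp (-b ^ 2 / (2 * σ ^ 2)) := by
    intro i n hn
    have h := hasSubgaussianMGF_sum_row hν i n
    have h1 := h.measure_ge_le (ε := b * √(n : ℝ)) (by positivity)
    have h2 := h.neg.measure_ge_le (ε := b * √(n : ℝ)) (by positivity)
    rw [hexp n hn] at h1 h2
    exact (measureReal_union_le _ _).trans (by linarith)
  refine (measureReal_mono hsub (measure_ne_top _ _)).trans
    ((measureReal_biUnion_finset_le _ _).trans ?_)
  refine (Finset.sum_le_sum fun i _ => (measureReal_biUnion_finset_le _ _).trans
    (Finset.sum_le_sum (hone i))).trans (le_of_eq ?_)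
  simp

/-! ### Empirical means along a run -/

theorem histPulls_history {K T : ℕ} (x : Table K) (a : Fin T → Fin K) (t : Fin T) (i : Fin K) :
    histPulls (history x a t) i = pulls a i t :=
  pulls_prefix a t.isLt.le i le_rfl

theorem sum_reward_prefix {K T : ℕ} (x : Table K) (a : Fin T → Fin K) (i : Fin K) {t : ℕ}
    (ht : t ≤ T) :
    (∑ s : Fin t, if a (s.castLE ht) = i then reward x a (s.castLE ht) else 0)
      = ∑ k ∈ Finset.range (pulls a i t), x (i, k) := by
  induction t with
  | zero => simp [pulls_zero]
  | succ t ih =>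
    rw [Fin.sum_univ_castSucc]
    have h1 := ih (by omega)
    have h2 := pulls_succ a i ⟨t, ht⟩
    have e : ∀ s : Fin t, (s.castSucc).castLE ht = s.castLE (by omega) := fun s => rfl
    have e' : (Fin.last t).castLE ht = ⟨t, ht⟩ := rfl
    simp only [e, e', h1]
    simp only at h2
    rw [h2]
    split_ifs with h
    · rw [Finset.sum_range_succ]
      simp only [reward, h]
    · simp

theorem empMean_history {K T : ℕ} (x : Table K) (a : Fin T → Fin K) (t : Fin T) (i : Fin K) :
    empMean (history x a t) i =
      (∑ k ∈ Finset.range (pulls a i t), x (i, k)) / (pulls a i t : ℝ) := by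
  unfold empMean
  rw [histPulls_history, ← sum_reward_prefix x a i t.isLt.le]
  rfl

theorem abs_empMean_sub_le {K T : ℕ} {ν : Instance K} {b : ℝ} {x : Table K}
    (hx : x ∈ concentrationSet ν T b) (a : Fin T → Fin K) (t : Fin T) (i : Fin K)
    (hpos : 1 ≤ pulls a i t) :
    |empMean (history x a t) i - mean ν i| ≤ b / √(pulls a i t : ℝ) := by
  have hN : (0 : ℝ) < pulls a i t := by exact_mod_cast hpos
  have h := hx i (pulls a i t)
    (Finset.mem_Icc.2 ⟨hpos, (pulls_le a i t.isLt.le).trans t.isLt.le⟩)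
  rw [Finset.sum_sub_distrib, Finset.sum_const, Finset.card_range, nsmul_eq_mul] at h
  rw [empMean_history]
  have e : (∑ k ∈ Finset.range (pulls a i t), x (i, k)) / (pulls a i t : ℝ) - mean ν i
      = (∑ k ∈ Finset.range (pulls a i t), x (i, k) - pulls a i t * mean ν i)
        / (pulls a i t : ℝ) := by
    field_simp
  rw [e, abs_div, abs_of_pos hN, div_le_div_iff₀ hN (Real.sqrt_pos.2 hN)]
  calc _ ≤ b * √(pulls a i t : ℝ) * √(pulls a i t : ℝ) :=
        mul_le_mul_of_nonneg_right h (Real.sqrt_nonneg _)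
    _ = _ := by rw [mul_assoc, Real.mul_self_sqrt hN.le]

/-! ### Last pulls and index comparisons -/

theorem pulls_mono {K n : ℕ} (a : Fin n → Fin K) (i : Fin K) {s t : ℕ} (h : s ≤ t) :
    pulls a i s ≤ pulls a i t := by
  refine Finset.card_le_card fun r hr => ?_
  simp only [Finset.mem_filter, Finset.mem_univ, true_and] at hr ⊢
  exact ⟨by omega, hr.2⟩

theorem exists_last_pull {K n : ℕ} (a : Fin n → Fin K) (i : Fin K) {t : ℕ} (ht : t ≤ n)
    (h : 1 ≤ pulls a i t) : ∃ s : Fin n, a s = i ∧ pulls a i s + 1 = pulls a i t := by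
  induction t with
  | zero => simp [pulls_zero] at h
  | succ t ih =>
    have h2 := pulls_succ a i ⟨t, ht⟩
    simp only at h2
    by_cases ha : a ⟨t, ht⟩ = i
    · exact ⟨⟨t, ht⟩, ha, by rw [h2, if_pos ha]⟩
    · rw [if_neg ha, add_zero] at h2
      rw [h2] at h ⊢
      exact ih (by omega) h

theorem one_le_pulls_of_ucbChoices {T : ℕ} {f : ℕ → ℝ} {x : Table 2} {a : Fin T → Fin 2}
    (ha : ∀ t, a t ∈ ucbChoices f (history x a t)) (i : Fin 2) (t : Fin T) (ht : 2 ≤ (t : ℕ)) :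
    1 ≤ pulls a i t := by
  have hT := t.isLt
  refine le_trans ?_ (pulls_mono a i ht)
  have h1 := pulls_succ a i ⟨0, by omega⟩
  have h2 := pulls_succ a i ⟨1, by omega⟩
  have h3 := pulls_succ a (a ⟨1, by omega⟩) ⟨0, by omega⟩
  have h4 := (ha ⟨1, by omega⟩).1 (by norm_num)
  rw [histPulls_history] at h4
  simp only [zero_add, pulls_zero] at h1 h2 h3 h4
  rw [h4] at h3
  have hne : a ⟨0, by omega⟩ ≠ a ⟨1, by omega⟩ := by
    intro h
    rw [if_pos h] at h3
    exact absurd h3 (by norm_num)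
  have hor : a ⟨0, by omega⟩ = i ∨ a ⟨1, by omega⟩ = i := by
    generalize a ⟨0, by omega⟩ = p at *
    generalize a ⟨1, by omega⟩ = q at *
    revert p q i
    omega
  change 1 ≤ pulls a i (1 + 1)
  rw [h2, h1]
  rcases hor with h | h <;> simp [h]

/-- On the concentration event the noise only perturbs the exploration bonus by `b`, so the choice
of an arm becomes a deterministic inequality between counts. -/
theorem index_le_of_ucbChoices {T : ℕ} {f : ℕ → ℝ} {ν : Instance 2} {b : ℝ} {x : Table 2}
    {a : Fin T → Fin 2} (hx : x ∈ concentrationSet ν T b)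
    (ha : ∀ t, a t ∈ ucbChoices f (history x a t)) (t : Fin T) (ht : 2 ≤ (t : ℕ)) (j : Fin 2) :
    mean ν j + (f (t + 1) - b) / √(pulls a j t : ℝ)
      ≤ mean ν (a t) + (f (t + 1) + b) / √(pulls a (a t) t : ℝ) := by
  have h := (ha t).2 ht j
  unfold ucbIndex at h
  rw [histPulls_history, histPulls_history] at h
  have h1 := abs_le.1 (abs_empMean_sub_le hx a t j (one_le_pulls_of_ucbChoices ha j t ht))
  have h2 := abs_le.1 (abs_empMean_sub_le hx a t (a t) (one_le_pulls_of_ucbChoices ha _ t ht))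
  rw [sub_div, add_div]
  linarith [h1.1, h2.2]

/-! ### The deterministic dynamics -/

theorem exists_balanced_split {T D : ℝ} (hT : 0 < T) (hD : 0 ≤ D) :
    -- Intermediate values on `[n₀, T/2]`: the difference vanishes at `T/2`, and `n₀` is chosen with
    -- `1 / √n₀ = D + 1 / √(T/2)`, so that it is at least `D` there.
    ∃ n m : ℝ, 0 < n ∧ n ≤ m ∧ n + m = T ∧ 1 / √n - 1 / √m = D := by
  have hh : 0 < √(T / 2) := Real.sqrt_pos.2 (by linarith)
  set w := D + 1 / √(T / 2) with hw
  have hwpos : 0 < w := by positivity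
  set n₀ := (1 / w) ^ 2 with hn₀
  have hn₀pos : 0 < n₀ := by positivity
  have hs : √n₀ = 1 / w := Real.sqrt_sq (by positivity)
  have hle : n₀ ≤ T / 2 := by
    rw [← Real.sqrt_le_sqrt_iff (by linarith), hs, div_le_iff₀ hwpos, hw, mul_add,
      mul_one_div_cancel hh.ne']
    nlinarith
  have hcont : ContinuousOn (fun n : ℝ => 1 / √n - 1 / √(T - n)) (Set.Icc n₀ (T / 2)) := by
    refine ContinuousOn.sub ?_ ?_
    · exact continuousOn_const.div Real.continuous_sqrt.continuousOn fun n hn =>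
        (Real.sqrt_pos.2 (by linarith [hn.1])).ne'
    · exact continuousOn_const.div
        (Real.continuous_sqrt.comp (continuous_const.sub continuous_id)).continuousOn fun n hn =>
        (Real.sqrt_pos.2 (by linarith [hn.2])).ne'
  have hmem : D ∈ Set.Icc (1 / √(T / 2) - 1 / √(T - T / 2)) (1 / √n₀ - 1 / √(T - n₀)) := by
    constructor
    · rw [show T - T / 2 = T / 2 by ring, sub_self]
      exact hD
    · rw [hs, one_div_one_div, hw]
      have : 1 / √(T - n₀) ≤ 1 / √(T / 2) :=
        one_div_le_one_div_of_le hh (Real.sqrt_le_sqrt (by linarith))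
      linarith
  obtain ⟨n, hn, hnD⟩ := intermediate_value_Icc' hle hcont hmem
  exact ⟨n, T - n, by linarith [hn.1], by linarith [hn.2], by ring, hnD⟩

/-- `X²`, `Y²` are the counts of the better and worse arm at a pull of the worse one. If `Y > N`
then `X ≤ M`, and comparison with the balanced split gives `F (Y - N) ≤ 2 b Y`. The pull itself
gives `Δ Y ≤ 2 F`. In the product of the two bounds `F` cancels. -/
theorem gap_mul_sub_le_of_suboptimal_pull {F G b Δ N M X Y : ℝ} (hF : 0 < F) (hFG : F ≤ G)
    (hb : 0 ≤ b) (hbF : 4 * b ≤ F) (hΔ : 0 ≤ Δ) (hN : 0 < N) (hNM : N ≤ M) (hX : 0 < X)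
    (hY : 0 < Y) (hsplit : 1 / N - 1 / M = Δ / G) (hsum : X ^ 2 + Y ^ 2 ≤ N ^ 2 + M ^ 2)
    (h : Δ ≤ (F + b) / Y - (F - b) / X) : Δ * (Y ^ 2 - N ^ 2) ≤ 8 * b * Y := by
  have hM : 0 < M := by linarith
  have hG : 0 < G := by linarith
  rcases le_total Y N with hYN | hYN
  · have : Δ * (Y ^ 2 - N ^ 2) ≤ 0 := mul_nonpos_of_nonneg_of_nonpos hΔ (by nlinarith)
    linarith [show 0 ≤ 8 * b * Y by positivity]
  have hXM : X ≤ M := by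
    refine le_of_sq_le_sq ?_ hM.le
    have := pow_le_pow_left₀ hN.le hYN 2
    linarith
  have hq : 1 / M ≤ 1 / X := one_div_le_one_div_of_le hX hXM
  have hpq : 1 / M ≤ 1 / N := one_div_le_one_div_of_le hN hNM
  have e1 : (F + b) / Y = (F + b) * (1 / Y) := by ring
  have e2 : (F - b) / X = (F - b) * (1 / X) := by ring
  rw [e1, e2] at h
  have hX' : 0 < 1 / X := by positivity
  have hΔ1 : F * (1 / N - 1 / M) ≤ Δ := by
    rw [hsplit]
    calc F * (Δ / G) ≤ G * (Δ / G) := mul_le_mul_of_nonneg_right hFG (by positivity)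
      _ = Δ := mul_div_cancel₀ _ hG.ne'
  have h1 : (F - b) * (1 / N) ≤ (F + b) * (1 / Y) := by
    have a1 := mul_le_mul_of_nonneg_left hq (show 0 ≤ F - b by linarith)
    have a2 := mul_le_mul_of_nonneg_left hpq hb
    linarith
  have h2 : (F - b) * Y ≤ (F + b) * N := by
    rw [mul_one_div, mul_one_div, div_le_div_iff₀ hN hY] at h1
    exact h1
  have h3 : Δ * Y ≤ 2 * F := by
    have a1 : Δ ≤ (F + b) / Y := by
      rw [e1]
      have : 0 ≤ (F - b) * (1 / X) := mul_nonneg (by linarith) hX'.le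
      linarith
    rw [le_div_iff₀ hY] at a1
    linarith
  have h4 : F * (Y - N) ≤ 2 * b * Y := by
    have := mul_le_mul_of_nonneg_left hYN hb
    linarith
  calc Δ * (Y ^ 2 - N ^ 2) = (Δ * (Y - N)) * (Y + N) := by ring
    _ ≤ (Δ * (Y - N)) * (2 * Y) :=
        mul_le_mul_of_nonneg_left (by linarith) (mul_nonneg hΔ (by linarith))
    _ = 2 * ((Δ * Y) * (Y - N)) := by ring
    _ ≤ 2 * ((2 * F) * (Y - N)) := by
        have := mul_le_mul_of_nonneg_right h3 (show 0 ≤ Y - N by linarith)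
        linarith
    _ ≤ 8 * b * Y := by linarith

/-- Mirror image at a pull of the better arm. Now `F ≤ G` goes the wrong way, so the root counts are
multiplied by `r`, which carries the earlier round to the horizon, and `G ≤ r F` replaces it. If `X
> M` then `r Y ≤ N`, `F (N - r Y) ≤ 2 b N` and `Δ N ≤ r F`; again `F` cancels. -/
theorem gap_mul_sub_le_of_optimal_pull {F G b Δ N M X Y r : ℝ} (hF : 0 < F) (hG : 0 < G)
    (hr : 1 ≤ r) (hFG : G ≤ r * F)
    (hb : 0 ≤ b) (hΔ : 0 ≤ Δ) (hN : 0 < N) (hNM : N ≤ M) (hX : 0 < X)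
    (hY : 0 < Y) (hsplit : 1 / N - 1 / M = Δ / G)
    (hsum : r ^ 2 * (X ^ 2 + Y ^ 2) ≤ N ^ 2 + M ^ 2)
    (h : (F - b) / Y - (F + b) / X ≤ Δ) : Δ * (X ^ 2 - M ^ 2) ≤ 4 * b * N := by
  have hM : 0 < M := by linarith
  rcases le_total X M with hXM | hXM
  · have : Δ * (X ^ 2 - M ^ 2) ≤ 0 := mul_nonpos_of_nonneg_of_nonpos hΔ (by nlinarith)
    linarith [show 0 ≤ 4 * b * N by positivity]
  have hr0 : 0 < r := by linarith
  have hrX : M ≤ r * X := by nlinarith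
  have hΔG : Δ = G * (1 / N - 1 / M) := by rw [hsplit, mul_div_cancel₀ _ hG.ne']
  have hpq : 1 / M ≤ 1 / N := one_div_le_one_div_of_le hN hNM
  have hM' : 0 < 1 / M := by positivity
  have hΔ1 : Δ ≤ r * F * (1 / N - 1 / M) := by
    rw [hΔG]
    exact mul_le_mul_of_nonneg_right hFG (by linarith)
  have hXr : 1 / X ≤ r * (1 / M) := by
    rw [mul_one_div, div_le_div_iff₀ hX hM, one_mul]
    exact hrX
  have h1 : (F - b) * (1 / Y) ≤ r * (F + b) * (1 / N) := by
    have e1 : (F - b) / Y = (F - b) * (1 / Y) := by ring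
    have e2 : (F + b) / X = (F + b) * (1 / X) := by ring
    rw [e1, e2] at h
    have a1 := mul_le_mul_of_nonneg_left hXr (show 0 ≤ F + b by linarith)
    have a2 := mul_le_mul_of_nonneg_left hpq (show 0 ≤ r * b by positivity)
    linarith
  have h2 : (F - b) * N ≤ (F + b) * (r * Y) := by
    rw [mul_one_div, mul_one_div, div_le_div_iff₀ hY hN] at h1
    linarith
  have hZN : r * Y ≤ N := by
    refine le_of_sq_le_sq ?_ hN.le
    have := pow_le_pow_left₀ hM.le hrX 2
    rw [mul_pow] at this ⊢
    linarith
  have h3 : F * (N - r * Y) ≤ 2 * b * N := by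
    have := mul_le_mul_of_nonneg_left hZN hb
    linarith
  have hΔN : Δ * N ≤ r * F := by
    have a1 : Δ ≤ r * F * (1 / N) := hΔ1.trans
      (mul_le_mul_of_nonneg_left (by linarith) (by positivity))
    rw [mul_one_div, le_div_iff₀ hN] at a1
    exact a1
  have h4 : r ^ 2 * (X ^ 2 - M ^ 2) ≤ 2 * N * (N - r * Y) := by
    have a1 : r ^ 2 * X ^ 2 ≤ N ^ 2 + M ^ 2 - (r * Y) ^ 2 := by
      rw [mul_pow]; linarith
    have a2 : M ^ 2 ≤ r ^ 2 * M ^ 2 :=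
      le_mul_of_one_le_left (sq_nonneg M) (one_le_pow₀ hr)
    have a3 : N ^ 2 - (r * Y) ^ 2 ≤ 2 * N * (N - r * Y) := by nlinarith [sq_nonneg (N - r * Y)]
    linarith
  have h5 : r ^ 2 * (Δ * (X ^ 2 - M ^ 2)) ≤ r * (4 * b * N) := by
    calc r ^ 2 * (Δ * (X ^ 2 - M ^ 2)) = Δ * (r ^ 2 * (X ^ 2 - M ^ 2)) := by ring
      _ ≤ Δ * (2 * N * (N - r * Y)) := mul_le_mul_of_nonneg_left h4 hΔ
      _ = 2 * ((Δ * N) * (N - r * Y)) := by ring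
      _ ≤ 2 * ((r * F) * (N - r * Y)) := by
        have := mul_le_mul_of_nonneg_right hΔN (show 0 ≤ N - r * Y by linarith)
        linarith
      _ = 2 * r * (F * (N - r * Y)) := by ring
      _ ≤ 2 * r * (2 * b * N) := mul_le_mul_of_nonneg_left h3 (by positivity)
      _ = r * (4 * b * N) := by ring
  have h6 : r * (Δ * (X ^ 2 - M ^ 2)) ≤ 4 * b * N := by
    refine le_of_mul_le_mul_left ?_ hr0
    calc r * (r * (Δ * (X ^ 2 - M ^ 2))) = r ^ 2 * (Δ * (X ^ 2 - M ^ 2)) := by ring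
      _ ≤ _ := h5
  have h7 : 0 ≤ Δ * (X ^ 2 - M ^ 2) := mul_nonneg hΔ (by
    have := pow_le_pow_left₀ hM.le hXM 2
    linarith)
  exact (le_mul_of_one_le_left h7 hr).trans h6

end MAB

namespace MAB

/-! ### Regret of UCB-f on two arms -/

theorem abs_gap_mul_pulls_sub_le {T : ℕ} {f : ℕ → ℝ} {ν : Instance 2} {b n m : ℝ} {x : Table 2}
    {a : Fin T → Fin 2} {i j : Fin 2} (hij : i ≠ j) (hmean : mean ν i ≤ mean ν j) (hT : 1 ≤ T)
    (hb : 0 ≤ b)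
    (hf : ∀ t : ℕ, √(T : ℝ) ≤ t → t ≤ T →
      0 < f t ∧ 4 * b ≤ f t ∧ f t ≤ f T ∧ √(t : ℝ) / f t ≤ √(T : ℝ) / f T)
    (hx : x ∈ concentrationSet ν T b) (ha : ∀ t, a t ∈ ucbChoices f (history x a t))
    (hn : 0 < n) (hnm : n ≤ m) (hnmT : n + m = T)
    (hsplit : 1 / √n - 1 / √m = (mean ν j - mean ν i) / f T) :
    |(mean ν j - mean ν i) * pulls a i T - (mean ν j - mean ν i) * n|
      ≤ 8 * b * √T + (mean ν j - mean ν i) * (√T + 2) := by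
  set Δ := mean ν j - mean ν i with hΔdef
  have hΔ : 0 ≤ Δ := sub_nonneg.2 hmean
  have hT1 : (1 : ℝ) ≤ T := by exact_mod_cast hT
  have hsT : 1 ≤ √(T : ℝ) := Real.one_le_sqrt.2 hT1
  have hm : 0 < m := by linarith
  have hNpos : 0 < √n := Real.sqrt_pos.2 hn
  have hNM : √n ≤ √m := Real.sqrt_le_sqrt hnm
  have hNsq : √n ^ 2 = n := Real.sq_sqrt hn.le
  have hMsq : √m ^ 2 = m := Real.sq_sqrt hm.le
  have hbT : 0 ≤ b * √(T : ℝ) := by positivity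
  -- An arm with more than `√T + 2` pulls was last pulled after the initial rounds and after round
  -- `√T`, where the bounds on `f` hold. Index `t` is round `t + 1`.
  have hlast : ∀ k : Fin 2, √(T : ℝ) + 2 < pulls a k T → ∃ t : Fin T, a t = k ∧
      (pulls a k t : ℝ) + 1 = pulls a k T ∧ 2 ≤ (t : ℕ) ∧ √(T : ℝ) ≤ ((t + 1 : ℕ) : ℝ) := by
    intro k hk
    have h1 : 1 ≤ pulls a k T := by
      have : (1 : ℝ) ≤ pulls a k T := by linarith
      exact_mod_cast this
    obtain ⟨t, hat, ht⟩ := exists_last_pull a k le_rfl h1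
    have ht' : (pulls a k t : ℝ) + 1 = pulls a k T := by exact_mod_cast ht
    have hle : (pulls a k t : ℝ) ≤ (t : ℕ) := by exact_mod_cast pulls_le a k t.isLt.le
    refine ⟨t, hat, ht', ?_, ?_⟩
    · have : (2 : ℝ) ≤ (t : ℕ) := by linarith
      exact_mod_cast this
    · push_cast; linarith
  rw [← mul_sub, abs_le]
  constructor
  -- A deficit of the worse arm `i` is an excess of `j` over `m`.
  · have hsum : (pulls a i T : ℝ) + pulls a j T = T := by
      exact_mod_cast pulls_fin_two a le_rfl hij
    rcases le_or_gt (pulls a j T : ℝ) (√T + 2) with h | h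
    · have : Δ * (pulls a j T - m) ≤ Δ * (√T + 2) := mul_le_mul_of_nonneg_left (by linarith) hΔ
      have e : Δ * (pulls a i T - n) = -(Δ * (pulls a j T - m)) := by
        linear_combination Δ * hsum - Δ * hnmT
      linarith
    · obtain ⟨t, hat, ht, ht2, hτ⟩ := hlast j h
      obtain ⟨hF, hbF, hFG, hratio⟩ := hf (t + 1) hτ t.isLt
      have hidx := index_le_of_ucbChoices hx ha t ht2 i
      rw [hat] at hidx
      have hposi : (0 : ℝ) < pulls a i t := by
        exact_mod_cast one_le_pulls_of_ucbChoices ha i t ht2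
      have hposj : (0 : ℝ) < pulls a j t := by
        exact_mod_cast one_le_pulls_of_ucbChoices ha j t ht2
      have hsumt : (pulls a i t : ℝ) + pulls a j t = (t : ℕ) := by
        exact_mod_cast pulls_fin_two a t.isLt.le hij
      have hτpos : (0 : ℝ) < ((t + 1 : ℕ) : ℝ) := by positivity
      have hτT : ((t + 1 : ℕ) : ℝ) ≤ T := by exact_mod_cast t.isLt
      have hG : 0 < f T := by linarith
      have key := gap_mul_sub_le_of_optimal_pull (F := f (t + 1)) (G := f T) (b := b) (Δ := Δ)
        (N := √n) (M := √m) (X := √(pulls a j t : ℝ)) (Y := √(pulls a i t : ℝ))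
        (r := √(T : ℝ) / √((t + 1 : ℕ) : ℝ)) hF hG
        ((one_le_div (Real.sqrt_pos.2 hτpos)).2 (Real.sqrt_le_sqrt hτT))
        (by
          rw [div_le_div_iff₀ hF hG] at hratio
          rw [div_mul_eq_mul_div, le_div_iff₀ (Real.sqrt_pos.2 hτpos)]
          linarith)
        hb hΔ hNpos hNM (Real.sqrt_pos.2 hposj) (Real.sqrt_pos.2 hposi) hsplit
        (by
          rw [div_pow, Real.sq_sqrt (by positivity), Real.sq_sqrt hτpos.le,
            Real.sq_sqrt hposj.le, Real.sq_sqrt hposi.le, hNsq, hMsq, hnmT,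
            add_comm (pulls a j t : ℝ), hsumt,
            div_mul_eq_mul_div, div_le_iff₀ hτpos]
          exact mul_le_mul_of_nonneg_left (by push_cast; linarith) (by positivity))
        (by rw [hΔdef]; linarith)
      rw [Real.sq_sqrt hposj.le, hMsq] at key
      have hNT : b * √n ≤ b * √T :=
        mul_le_mul_of_nonneg_left (Real.sqrt_le_sqrt (by linarith)) hb
      have e : Δ * (pulls a i T - n) = -(Δ * (pulls a j t - m)) - Δ := by
        linear_combination Δ * hsum - Δ * hnmT + Δ * ht
      have : 0 ≤ Δ * (√T + 1) := by positivity
      linarith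
  · rcases le_or_gt (pulls a i T : ℝ) (√T + 2) with h | h
    · have : Δ * (pulls a i T - n) ≤ Δ * (√T + 2) := mul_le_mul_of_nonneg_left (by linarith) hΔ
      linarith
    · obtain ⟨t, hat, ht, ht2, hτ⟩ := hlast i h
      obtain ⟨hF, hbF, hFG, -⟩ := hf (t + 1) hτ t.isLt
      have hidx := index_le_of_ucbChoices hx ha t ht2 j
      rw [hat] at hidx
      have hposi : (0 : ℝ) < pulls a i t := by
        exact_mod_cast one_le_pulls_of_ucbChoices ha i t ht2
      have hposj : (0 : ℝ) < pulls a j t := by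
        exact_mod_cast one_le_pulls_of_ucbChoices ha j t ht2
      have hsumt : (pulls a i t : ℝ) + pulls a j t = (t : ℕ) := by
        exact_mod_cast pulls_fin_two a t.isLt.le hij
      have htT : ((t : ℕ) : ℝ) ≤ T := by exact_mod_cast t.isLt.le
      have key := gap_mul_sub_le_of_suboptimal_pull (F := f (t + 1)) (G := f T) (b := b) (Δ := Δ)
        (N := √n) (M := √m) (X := √(pulls a j t : ℝ)) (Y := √(pulls a i t : ℝ)) hF hFG
        hb hbF hΔ hNpos hNM (Real.sqrt_pos.2 hposj) (Real.sqrt_pos.2 hposi) hsplit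
        (by
          rw [Real.sq_sqrt hposj.le, Real.sq_sqrt hposi.le, hNsq, hMsq, hnmT]
          linarith)
        (by rw [hΔdef]; linarith)
      rw [Real.sq_sqrt hposi.le, hNsq] at key
      have hYT : b * √(pulls a i t : ℝ) ≤ b * √T :=
        mul_le_mul_of_nonneg_left (Real.sqrt_le_sqrt (by linarith)) hb
      have e : Δ * (pulls a i T - n) = Δ * (pulls a i t - n) + Δ := by
        linear_combination -Δ * ht
      have : 0 ≤ Δ * (√T + 1) := by positivity
      linarith

theorem ae_mem_ucbChoices {f : ℕ → ℝ} {K T : ℕ} {π : Policy K T} (ν : Instance K)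
    (hπ : ∀ (t : Fin T) (h : History K t), π.rule t h (ucbChoices f h)ᶜ = 0) :
    ∀ᵐ ω ∂(runLaw π ν), ∀ t, ω.2 t ∈ ucbChoices f (history ω.1 ω.2 t) := by
  filter_upwards [ae_runLaw_playProb_ne_zero π ν] with ω hω t
  by_contra hne
  refine hω (Finset.prod_eq_zero (Finset.mem_univ t) ?_)
  exact measure_mono_null (Set.singleton_subset_iff.2 hne) (hπ t _)

theorem exists_le_mean_fin_two (ν : Instance 2) :
    ∃ i j : Fin 2, i ≠ j ∧ mean ν i ≤ mean ν j ∧ ∀ (T : ℕ) (ω : Table 2 × (Fin T → Fin 2)),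
      pseudoRegret ν ω = (mean ν j - mean ν i) * pulls ω.2 i T := by
  rcases le_total (mean ν 0) (mean ν 1) with h | h
  · refine ⟨0, 1, by decide, h, fun T ω => ?_⟩
    simp [pseudoRegret, Fin.sum_univ_two, gap_fin_two, max_eq_right h, pullCount]
  · refine ⟨1, 0, by decide, h, fun T ω => ?_⟩
    simp [pseudoRegret, Fin.sum_univ_two, gap_fin_two, max_eq_left h, pullCount]

theorem regretSD_le_of_ucb {M σ : ℝ} (hσ : 0 < σ) {T : ℕ} (hT : 1 ≤ T)
    {f : ℕ → ℝ} {π : Policy 2 T}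
    (hπ : ∀ (t : Fin T) (h : History 2 t), π.rule t h (ucbChoices f h)ᶜ = 0)
    {ν : Instance 2} (hν : IsSubGaussianInstance M σ ν)
    (hf : ∀ t : ℕ, √(T : ℝ) ≤ t → t ≤ T → 0 < f t ∧ 4 * (σ * √(8 * Real.log T)) ≤ f t ∧
      f t ≤ f T ∧ √(t : ℝ) / f t ≤ √(T : ℝ) / f T) :
    regretSD π ν ≤ 8 * (σ * √(8 * Real.log T)) * √T + 2 * M * (√T + 2) + 4 * M := by
  obtain ⟨i, j, hij, hmean, hR⟩ := exists_le_mean_fin_two ν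
  set Δ := mean ν j - mean ν i with hΔdef
  set b := σ * √(8 * Real.log T) with hbdef
  have hT1 : (1 : ℝ) ≤ T := by exact_mod_cast hT
  have hlog : 0 ≤ Real.log T := Real.log_nonneg hT1
  have hb : 0 ≤ b := by positivity
  have hΔ : 0 ≤ Δ := sub_nonneg.2 hmean
  have hΔM : Δ ≤ 2 * M := by
    have h1 := (hν i).1.1
    have h2 := (hν j).1.2
    linarith
  have hM : 0 ≤ M := by linarith
  have hsT : √(T : ℝ) ≤ T := Real.sqrt_le_iff.2 ⟨by positivity, by nlinarith⟩
  have hfT := (hf T hsT le_rfl).1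
  -- `Δ n` serves as a deterministic centre: the variance is at most the second moment about it.
  obtain ⟨n, m, hn, hnm, hnmT, hsplit⟩ := exists_balanced_split (T := T) (D := Δ / f T)
    (by linarith) (by positivity)
  set C := 8 * b * √T + 2 * M * (√T + 2) with hC
  have hC0 : 0 ≤ C := by positivity
  set bad : Set (Table 2) := (concentrationSet ν T b)ᶜ with hbad
  have hbadm : MeasurableSet bad := (measurableSet_concentrationSet ν T b).compl
  have hmemR : MemLp (pseudoRegret ν) 2 (runLaw π ν) := by
    have : pseudoRegret (T := T) ν = fun ω => Δ * (pulls ω.2 i T : ℝ) := funext (hR T)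
    rw [this]
    exact memLp_of_snd π ν (fun a => Δ * (pulls a i T : ℝ)) 2
  have hpt : ∀ᵐ ω ∂(runLaw π ν), (pseudoRegret ν ω - Δ * n) ^ 2 ≤
      C ^ 2 + (2 * M * T) ^ 2 * bad.indicator 1 ω.1 := by
    filter_upwards [ae_mem_ucbChoices ν hπ] with ω hω
    rw [hR]
    by_cases hx : ω.1 ∈ concentrationSet ν T b
    · have h := abs_gap_mul_pulls_sub_le hij hmean hT hb hf hx hω hn hnm hnmT hsplit
      rw [Set.indicator_of_notMem (by simpa [hbad] using hx), mul_zero, add_zero]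
      have h2 : |Δ * (pulls ω.2 i T : ℝ) - Δ * n| ≤ C := by
        refine h.trans ?_
        have := mul_le_mul_of_nonneg_right hΔM (show 0 ≤ √(T : ℝ) + 2 by positivity)
        linarith
      rw [← sq_abs]
      exact pow_le_pow_left₀ (abs_nonneg _) h2 2
    · rw [Set.indicator_of_mem (by simpa [hbad] using hx), Pi.one_apply, mul_one]
      have h1 : (pulls ω.2 i T : ℝ) ≤ T := by exact_mod_cast pulls_le ω.2 i le_rfl
      have h2 : |(pulls ω.2 i T : ℝ) - n| ≤ T := by
        have : (0 : ℝ) ≤ pulls ω.2 i T := by positivity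
        rw [abs_le]
        constructor <;> linarith
      have h3 : |Δ * (pulls ω.2 i T : ℝ) - Δ * n| ≤ 2 * M * T := by
        rw [← mul_sub, abs_mul, abs_of_nonneg hΔ]
        exact mul_le_mul hΔM h2 (abs_nonneg _) (by positivity)
      rw [← sq_abs]
      have := pow_le_pow_left₀ (abs_nonneg _) h3 2
      linarith [sq_nonneg C]
  have hind : Integrable (fun ω : Table 2 × (Fin T → Fin 2) => bad.indicator (1 : Table 2 → ℝ) ω.1)
      (runLaw π ν) := by
    refine Integrable.of_bound ((measurable_one.indicator hbadm).comp
      measurable_fst).aestronglyMeasurable 1 (ae_of_all _ fun ω => ?_)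
    by_cases h : ω.1 ∈ bad <;> simp [h]
  have hbadint : ∫ ω, bad.indicator (1 : Table 2 → ℝ) ω.1 ∂(runLaw π ν)
      = (tableLaw ν).real bad := by
    rw [← integral_indicator_one hbadm, ← map_fst_runLaw π ν,
      integral_map measurable_fst.aemeasurable (measurable_one.indicator hbadm).aestronglyMeasurable]
  -- The factor `8` in `b` makes each tail `T⁻⁴`, and there are `4 T` of them. Against the trivial
  -- bound `(2 M T)²` this leaves at most `16 M²`.
  have hprob : (tableLaw ν).real bad ≤ 4 / T ^ 3 := by
    have h := measureReal_compl_concentrationSet_le hσ hν T hb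
    have e : -b ^ 2 / (2 * σ ^ 2) = -(4 * Real.log T) := by
      rw [hbdef, mul_pow, Real.sq_sqrt (by positivity)]
      field_simp
      ring
    have e2 : Real.exp (-(4 * Real.log T)) = 1 / T ^ 4 := by
      rw [Real.exp_neg, show (4 : ℝ) * Real.log T = (4 : ℕ) * Real.log T by norm_num,
        Real.exp_nat_mul, Real.exp_log (by linarith), one_div]
    rw [e, e2] at h
    refine h.trans (le_of_eq ?_)
    push_cast
    field_simp
    norm_num
  have hvar : Var[pseudoRegret ν; runLaw π ν] ≤ C ^ 2 + (4 * M) ^ 2 := by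
    rw [← variance_sub_const hmemR.aestronglyMeasurable (Δ * n)]
    have hsubm : MemLp (fun ω => pseudoRegret ν ω - Δ * n) 2 (runLaw π ν) :=
      hmemR.sub (memLp_const _)
    refine (variance_le_expectation_sq hsubm.aestronglyMeasurable).trans ?_
    have h1 : ∫ ω, ((fun ω => pseudoRegret ν ω - Δ * n) ^ 2) ω ∂(runLaw π ν)
        ≤ ∫ ω, (C ^ 2 + (2 * M * T) ^ 2 * bad.indicator 1 ω.1) ∂(runLaw π ν) :=
      integral_mono_ae hsubm.integrable_sq ((integrable_const _).add (hind.const_mul _)) hpt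
    refine h1.trans ?_
    rw [integral_add (integrable_const _) (hind.const_mul _), integral_const_mul, hbadint,
      integral_const, probReal_univ, one_smul]
    have h2 : (2 * M * T) ^ 2 * (tableLaw ν).real bad ≤ (2 * M * T) ^ 2 * (4 / T ^ 3) :=
      mul_le_mul_of_nonneg_left hprob (sq_nonneg _)
    have h3 : (2 * M * T) ^ 2 * (4 / (T : ℝ) ^ 3) = (4 * M) ^ 2 / T := by
      field_simp
      ring
    have h4 : (4 * M) ^ 2 / (T : ℝ) ≤ (4 * M) ^ 2 := div_le_self (sq_nonneg _) hT1
    linarith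
  unfold regretSD
  refine (Real.sqrt_le_sqrt hvar).trans ?_
  refine Real.sqrt_le_iff.2 ⟨by positivity, ?_⟩
  nlinarith [mul_nonneg hC0 hM]

/-! ### Asymptotics for admissible exploration functions -/

theorem tendsto_log_natCast : Tendsto (fun T : ℕ => Real.log T) atTop atTop :=
  Real.tendsto_log_atTop.comp tendsto_natCast_atTop_atTop

theorem tendsto_sqrt_natCast : Tendsto (fun T : ℕ => √(T : ℝ)) atTop atTop :=
  Real.tendsto_sqrt_atTop.comp tendsto_natCast_atTop_atTop

/-- An admissible exploration function eventually dominates, on `[√T, T]`, any multiple of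
`√(log T)`. -/
theorem IsAdmissible.eventually_bounds {f : ℕ → ℝ} (hf : IsAdmissible f) {A : ℝ} :
    ∀ᶠ T : ℕ in atTop, ∀ t : ℕ, √(T : ℝ) ≤ t → t ≤ T → 0 < f t ∧ A * √(Real.log T) ≤ f t ∧
      f t ≤ f T ∧ √(t : ℝ) / f t ≤ √(T : ℝ) / f T := by
  obtain ⟨t₀, ht₀, hpos, hlogm, hsqm⟩ := hf
  have hlog₀ : 0 < Real.log t₀ := Real.log_pos (by exact_mod_cast ht₀)
  set c := f t₀ / Real.log t₀ with hc
  have hc0 : 0 < c := div_pos (hpos t₀ le_rfl) hlog₀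
  filter_upwards [tendsto_sqrt_natCast.eventually_ge_atTop (t₀ : ℝ),
    (Real.tendsto_sqrt_atTop.comp tendsto_log_natCast).eventually_ge_atTop (2 * A / c),
    eventually_ge_atTop 1] with T h1 h2 hT t ht htT
  have htt : t₀ ≤ t := by exact_mod_cast h1.trans ht
  have ht2 : (2 : ℝ) ≤ t := by exact_mod_cast ht₀.trans htt
  have hlogt : 0 < Real.log t := Real.log_pos (by linarith)
  have htT' : (t : ℝ) ≤ T := by exact_mod_cast htT
  have hlogT : Real.log t ≤ Real.log T := Real.log_le_log (by linarith) htT'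
  have hT0 : (0 : ℝ) < T := by exact_mod_cast hT
  -- For `t ≥ √T` the logarithms of `t` and `T` are comparable, so `f t ≥ c log t` is of order at
  -- least `log T`.
  have hhalf : Real.log T / 2 ≤ Real.log t := by
    rw [← Real.log_sqrt hT0.le]
    exact Real.log_le_log (Real.sqrt_pos.2 hT0) ht
  have hft : c * Real.log t ≤ f t := by
    have := hlogm (Set.mem_Ici.2 le_rfl) (Set.mem_Ici.2 htt) htt
    exact (le_div_iff₀ hlogt).1 this
  have hTT : t₀ ≤ T := htt.trans htT
  refine ⟨hpos t htt, ?_, ?_, hsqm htt hTT htT⟩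
  · rw [Function.comp, div_le_iff₀ hc0] at h2
    have h3 := mul_le_mul_of_nonneg_right h2 (Real.sqrt_nonneg (Real.log T))
    have h4 : √(Real.log T) * √(Real.log T) = Real.log T :=
      Real.mul_self_sqrt (by linarith)
    have h5 : √(Real.log T) * c * √(Real.log T) = c * Real.log T := by
      linear_combination c * h4
    have h6 := mul_le_mul_of_nonneg_left hhalf hc0.le
    linarith
  · have h3 := hlogm htt hTT htT
    simp only at h3
    rw [div_le_div_iff₀ hlogt (by linarith)] at h3
    have hfT := hpos T hTT
    refine le_of_mul_le_mul_right (h3.trans ?_) (show 0 < Real.log T by linarith)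
    exact mul_le_mul_of_nonneg_left hlogT hfT.le

theorem limsup_worstRegretSDTwo_lt {M σ : ℝ} (hM : 0 < M) (hσ : 0 < σ) {f : ℕ → ℝ}
    (hf : IsAdmissible f) {alg : Algorithm} (halg : IsUCB f alg) :
    limsup (fun T : ℕ =>
      worstRegretSDTwo M σ alg T / ENNReal.ofReal (√(T : ℝ) * Real.log T)) atTop
        < ENNReal.ofReal 1 := by
  refine lt_of_le_of_lt (limsup_le_of_le (a := ENNReal.ofReal (1 / 2)) (by isBoundedDefault) ?_)
    ((ENNReal.ofReal_lt_ofReal_iff one_pos).2 (by norm_num))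
  -- The threshold on `T` depends on `f`, `M` and `σ` but not on the instance, so the bound passes
  -- to the supremum. The second condition absorbs all constants into the spare factor `√(log T)`.
  filter_upwards [hf.eventually_bounds (A := 4 * (σ * √8)),
    (Real.tendsto_sqrt_atTop.comp tendsto_log_natCast).eventually_ge_atTop
      (2 * (8 * σ * √8 + 10 * M)),
    tendsto_log_natCast.eventually_ge_atTop 1, eventually_ge_atTop 1] with T hfT hbig hlog hT
  have hT1 : (1 : ℝ) ≤ T := by exact_mod_cast hT
  have hsT : 1 ≤ √(T : ℝ) := Real.one_le_sqrt.2 hT1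
  have hsl : 1 ≤ √(Real.log T) := Real.one_le_sqrt.2 hlog
  have hmul : √(8 * Real.log T) = √8 * √(Real.log T) := Real.sqrt_mul (by norm_num) _
  have hden : 0 < √(T : ℝ) * Real.log T := by positivity
  refine ENNReal.div_le_of_le_mul (iSup_le fun ν => iSup_le fun hν => ?_)
  rw [← ENNReal.ofReal_mul (by norm_num)]
  refine ENNReal.ofReal_le_ofReal ?_
  refine (regretSD_le_of_ucb hσ hT (fun t h => halg 2 le_rfl T t h) hν fun t h1 h2 => ?_).trans ?_
  · have := hfT t h1 h2
    rw [hmul]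
    refine ⟨this.1, ?_, this.2.2⟩
    linarith [this.2.1]
  · rw [hmul]
    simp only [Function.comp] at hbig
    have hss : √(Real.log T) * √(Real.log T) = Real.log T := Real.mul_self_sqrt (by linarith)
    have hprod : 1 ≤ √(T : ℝ) * √(Real.log T) := one_le_mul_of_one_le_of_one_le hsT hsl
    have hTl : √(T : ℝ) ≤ √(T : ℝ) * √(Real.log T) :=
      le_mul_of_one_le_right (by positivity) hsl
    calc 8 * (σ * (√8 * √(Real.log T))) * √T + 2 * M * (√T + 2) + 4 * M
        = 8 * σ * √8 * (√T * √(Real.log T)) + M * (2 * √T + 8) := by ring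
      _ ≤ 8 * σ * √8 * (√T * √(Real.log T)) + M * (10 * (√T * √(Real.log T))) := by
          have := mul_le_mul_of_nonneg_left
            (show 2 * √(T : ℝ) + 8 ≤ 10 * (√T * √(Real.log T)) by linarith) hM.le
          linarith
      _ = (8 * σ * √8 + 10 * M) * (√T * √(Real.log T)) := by ring
      _ ≤ (√(Real.log T) / 2) * (√T * √(Real.log T)) :=
          mul_le_mul_of_nonneg_right (by linarith) (by positivity)
      _ = 1 / 2 * (√T * Real.log T) := by linear_combination (√(T : ℝ) / 2) * hss

end MAB

theorem proposition2 (M σ : ℝ) (hM : 0 < M) (hσ : 0 < σ) (Kbar : ℕ) (hKbar : 2 ≤ Kbar) :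
    (∃ c₄ : ℝ, 0 < c₄ ∧ ∀ alg : MAB.Algorithm, MAB.IsActiveLearning M σ Kbar alg →
      ENNReal.ofReal c₄ < liminf (fun T : ℕ =>
        ENNReal.ofReal (Real.log T / √(T : ℝ)) * MAB.worstRegretSD M σ Kbar alg T) atTop) ∧
    (∃ c₅ : ℝ, 0 < c₅ ∧ ∀ f : ℕ → ℝ, MAB.IsAdmissible f →
      ∀ alg : MAB.Algorithm, MAB.IsUCB f alg →
      limsup (fun T : ℕ =>
        MAB.worstRegretSDTwo M σ alg T / ENNReal.ofReal (√(T : ℝ) * Real.log T)) atTop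
          < ENNReal.ofReal c₅) :=
  ⟨MAB.exists_lt_liminf_worstRegretSD hM hσ hKbar, 1, one_pos, fun _ hf _ halg =>
    MAB.limsup_worstRegretSDTwo_lt hM hσ hf halg⟩
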